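/- \textbf{Setting.} All systems are finite-dimensional and carry a fixed (incoherent) basis. A state is incoherent if its density matrix is diagonal in that basis. A family of Kraus operators $K_n$ (finitely many, possibly between different systems) is incoherent if $\sum_n K_n^\dagger K_n=\mathbb 1$ and $K_n\delta K_n^\dagger$ is diagonal for every incoherent state $\delta$ and every $n$; an ICPTP map is a map of the form $\Phi(\rho)=\sum_n K_n\rho K_n^\dagger$ with such a family. A coherence measure is an assignment $\rho\mapsto\mathcal C(\rho)\in\mathbb R$ on the states of all such systems satisfying (C1) $\mathcal C(\rho)\ge 0$, with equality if and only if $\rho$ is incoherent; (C2a) $\mathcal C(\Phi(\rho))\le\mathcal C(\rho)$ for every ICPTP map $\Phi$; (C2b) $\sum_n p_n\,\mathcal C(\rho_n)\le\mathcal C(\rho)$ for every incoherent Kraus family, where $p_n=\mathrm{Tr}[K_n\rho K_n^\dagger]$ and $\rho_n=K_n\rho K_n^\dagger/p_n$ (outcomes with $p_n=0$ are omitted); (C3) $\mathcal C(\lambda\rho+(1-\lambda)\sigma)\le\lambda\,\mathcal C(\rho)+(1-\lambda)\,\mathcal C(\sigma)$ for $0\le\lambda\le1$. The quantum Fisher information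 of a state with eigenvalues $\lambda_i$ and eigenvectors $|i\rangle$ is $\mathcal F(\rho,H)=2\sum_{\lambda_i+\lambda_j>0}\frac{(\lambda_i-\lambda_j)^2}{\lambda_i+\lambda_j}|\langle i|H|j\rangle|^2$. \textbf{The quantity.} Let $M,N\ge1$. For $1\le i\le M$, $1\le k\le N$ let particle $(i,k)$ be a finite-dimensional system with a fixed incoherent basis, let $h^{(i,k)}$ be a Hermitian operator on it which is diagonal in this basis and not proportional to the identity, let $|g^{(i,k)}\rangle\ne|e^{(i,k)}\rangle$ be two vectors of this basis, and set $D_+^{(i,k)}=|e^{(i,k)}\rangle\langle g^{(i,k)}|$, $D_-^{(i,k)}=|g^{(i,k)}\rangle\langle e^{(i,k)}|$. The $i$th collection $P(i)$ consists of the particles $(i,1),\dots,(i,N)$ and of ancillary particles of arbitrary finite total dimension with a fixed incoherent basis, on which $H_S^{(i)}=\sum_{k=1}^N h^{(i,k)}$ and the $D_\pm^{(i,k)}$ act trivially; collections carry the product basis. For a pure state $|\psi\rangle$ of any finite-dimensional system put $$\mathcal C_{SF}(|\psi\rangle)=\max_{\Phi}\ \sum_{i=1}^M\Big[\tfrac14\,\mathcal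 F\big(\mathrm{Tr}_{P(i)^c}[\Phi(|\psi\rangle\langle\psi|)],H_S^{(i)}\big)+\sum_{k\ne l}\mathrm{Tr}\big[\Phi(|\psi\rangle\langle\psi|)\,D_+^{(i,k)}D_-^{(i,l)}\big]\Big],$$ where the maximum is over all choices of the ancilla dimensions and all ICPTP maps $\Phi$ from the system of $|\psi\rangle$ to the joint system $P(1)\cdots P(M)$, and for a state $\rho$ put $$\mathcal C_{SF}(\rho)=\min_{\{p_m,|\psi_m\rangle\}}\ \sum_m p_m\,\mathcal C_{SF}(|\psi_m\rangle),$$ where the minimum is over all finite pure state decompositions $\rho=\sum_m p_m|\psi_m\rangle\langle\psi_m|$. \textbf{Theorem.} For all such $M$, $N$, $h^{(i,k)}$, $g^{(i,k)}$, $e^{(i,k)}$, the maximum and the minimum exist, and $\mathcal C_{SF}$ is a coherence measure. -/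

import Mathlib

open scoped Matrix Kronecker ComplexOrder

noncomputable section

namespace SFCoherence

/-! ### States, incoherent states and incoherent operations

A finite-dimensional system with a fixed incoherent basis is a finite type `ι` labelling that basis;
operators are complex matrices in that basis. -/

section Basic

variable {ι κ : Type} [Fintype ι] [Fintype κ] [DecidableEq ι] [DecidableEq κ]

/-- Density matrices. -/
def IsState (ρ : Matrix ι ι ℂ) : Prop := ρ.PosSemidef ∧ ρ.trace = 1

/-- Incoherent states: the diagonal density matrices. -/
def IsIncoherent (ρ : Matrix ι ι ℂ) : Prop := IsState ρ ∧ ρ.IsDiag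

/-- `ψ` is a unit vector. -/
def IsPure (ψ : ι → ℂ) : Prop := ∑ i, ‖ψ i‖ ^ 2 = 1

/-- The projector `|ψ⟩⟨ψ|`. -/
def proj (ψ : ι → ℂ) : Matrix ι ι ℂ := Matrix.vecMulVec ψ (star ψ)

/-- Incoherent Kraus families: `∑ₙ Kₙ† Kₙ = 1`, and each `Kₙ` maps incoherent states to
(unnormalized) incoherent states. -/
def IsIncoherentKraus {r : ℕ} (K : Fin r → Matrix κ ι ℂ) : Prop :=
  ∑ n, (K n)ᴴ * K n = 1 ∧ ∀ n, ∀ δ : Matrix ι ι ℂ, IsIncoherent δ → (K n * δ * (K n)ᴴ).IsDiag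

/-- Incoherent completely positive trace preserving maps (possibly between different systems):
the maps that possess an incoherent Kraus representation. -/
def IsICPTP (Φ : Matrix ι ι ℂ → Matrix κ κ ℂ) : Prop :=
  ∃ (r : ℕ) (K : Fin r → Matrix κ ι ℂ), IsIncoherentKraus K ∧
    ∀ ρ, Φ ρ = ∑ n, K n * ρ * (K n)ᴴ

/-- The probability of the outcome with Kraus operator `K`. -/
def outcomeProb (K : Matrix κ ι ℂ) (ρ : Matrix ι ι ℂ) : ℝ := (K * ρ * Kᴴ).trace.re

/-- The state after the outcome with Kraus operator `K` (relevant when it has nonzero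
probability). -/
def outcomeState (K : Matrix κ ι ℂ) (ρ : Matrix ι ι ℂ) : Matrix κ κ ℂ :=
  ((outcomeProb K ρ)⁻¹ : ℝ) • (K * ρ * Kᴴ)

/-- Quantum Fisher information `2 ∑ᵢⱼ (λᵢ - λⱼ)² / (λᵢ + λⱼ) |⟨i|H|j⟩|²`, where `λᵢ`, `|i⟩` are the
eigenvalues and eigenvectors of `ρ`. Terms with `λᵢ + λⱼ = 0` are omitted, as usual
(they vanish because `x / 0 = 0`). Only used for positive semidefinite `ρ`. -/
def qfi (ρ H : Matrix ι ι ℂ) : ℝ :=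
  open Classical in
  if hρ : ρ.IsHermitian then
    2 * ∑ i, ∑ j, (hρ.eigenvalues i - hρ.eigenvalues j) ^ 2 /
        (hρ.eigenvalues i + hρ.eigenvalues j) *
      ‖(star (hρ.eigenvectorUnitary : Matrix ι ι ℂ) * H *
        (hρ.eigenvectorUnitary : Matrix ι ι ℂ)) i j‖ ^ 2
  else 0

end Basic

/-- The axioms for a coherence measure. A measure assigns a number to each state of each
finite-dimensional system with a fixed incoherent basis. -/
structure IsCoherenceMeasure
    (C : ∀ (ι : Type) [Fintype ι] [DecidableEq ι], Matrix ι ι ℂ → ℝ) : Prop where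
  /-- (C1), nonnegativity. -/
  nonneg : ∀ (ι : Type) [Fintype ι] [DecidableEq ι] (ρ : Matrix ι ι ℂ), IsState ρ → 0 ≤ C ι ρ
  /-- (C1), faithfulness. -/
  eq_zero_iff : ∀ (ι : Type) [Fintype ι] [DecidableEq ι] (ρ : Matrix ι ι ℂ), IsState ρ →
    (C ι ρ = 0 ↔ IsIncoherent ρ)
  /-- (C2a), monotonicity. -/
  monotone : ∀ (ι κ : Type) [Fintype ι] [DecidableEq ι] [Fintype κ] [DecidableEq κ]
    (Φ : Matrix ι ι ℂ → Matrix κ κ ℂ), IsICPTP Φ →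
    ∀ ρ : Matrix ι ι ℂ, IsState ρ → C κ (Φ ρ) ≤ C ι ρ
  /-- (C2b), strong monotonicity (outcomes of probability zero contribute zero). -/
  strong_monotone : ∀ (ι κ : Type) [Fintype ι] [DecidableEq ι] [Fintype κ] [DecidableEq κ]
    (r : ℕ) (K : Fin r → Matrix κ ι ℂ), IsIncoherentKraus K →
    ∀ ρ : Matrix ι ι ℂ, IsState ρ →
      ∑ n, outcomeProb (K n) ρ * C κ (outcomeState (K n) ρ) ≤ C ι ρ
  /-- (C3), convexity. -/
  convex : ∀ (ι : Type) [Fintype ι] [DecidableEq ι] (ρ σ : Matrix ι ι ℂ),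
    IsState ρ → IsState σ → ∀ t : ℝ, 0 ≤ t → t ≤ 1 →
      C ι (t • ρ + (1 - t) • σ) ≤ t * C ι ρ + (1 - t) * C ι σ

/-! ### Composite systems -/

section Composite

variable {I : Type} [Fintype I] [DecidableEq I] {τ : I → Type} [∀ i, Fintype (τ i)]
  [∀ i, DecidableEq (τ i)]

/-- The operator on the tensor product of the systems `τ j` that acts as `B` on the factor `i` and
as the identity on all other factors. -/
def onFactor (i : I) (B : Matrix (τ i) (τ i) ℂ) : Matrix (∀ j, τ j) (∀ j, τ j) ℂ :=
  Matrix.of fun x y => if ∀ j, j ≠ i → x j = y j then B (x i) (y i) else 0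

/-- The partial trace over every factor except `i`. -/
def reduceTo (i : I) (ρ : Matrix (∀ j, τ j) (∀ j, τ j) ℂ) : Matrix (τ i) (τ i) ℂ :=
  Matrix.of fun a b => ∑ z : ∀ j, τ j, if z i = a then ρ z (Function.update z i b) else 0

end Composite

/-! ### The joint quantity -/

/-- The data of the joint superradiance / Fisher information task: `M` collections of `N` particles.
Particle `(i, k)` has a fixed incoherent basis, labelled by `Fin (dim i k)`; it carries a Hermitian
single-particle Hamiltonian `h i k`, diagonal in that basis and not proportional to the identity,
and an addressed transition between two distinct basis states `g i k` (ground) and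
`e i k` (excited). -/
structure Setup (M N : ℕ) where
  dim : Fin M → Fin N → ℕ
  h : ∀ i k, Matrix (Fin (dim i k)) (Fin (dim i k)) ℂ
  h_isHermitian : ∀ i k, (h i k).IsHermitian
  h_isDiag : ∀ i k, (h i k).IsDiag
  h_nontrivial : ∀ i k, ∀ c : ℂ, h i k ≠ c • 1
  g : ∀ i k, Fin (dim i k)
  e : ∀ i k, Fin (dim i k)
  g_ne_e : ∀ i k, g i k ≠ e i k

namespace Setup

variable {M N : ℕ} (S : Setup M N)

/-- Basis labels of the `i`th collection: its `N` particles that take part in the task, together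
with ancillary particles of total dimension `a i`, on which the task acts trivially. -/
abbrev Cell (a : Fin M → ℕ) (i : Fin M) : Type := (∀ k : Fin N, Fin (S.dim i k)) × Fin (a i)

/-- Basis labels of the whole output system, the tensor product of the `M` collections. -/
abbrev Out (a : Fin M → ℕ) : Type := ∀ i : Fin M, S.Cell a i

/-- A single-particle operator on particle `k` of collection `i`, acting on that collection. -/
def onParticle (a : Fin M → ℕ) (i : Fin M) (k : Fin N)
    (A : Matrix (Fin (S.dim i k)) (Fin (S.dim i k)) ℂ) :
    Matrix (S.Cell a i) (S.Cell a i) ℂ :=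
  onFactor (τ := fun k => Fin (S.dim i k)) k A ⊗ₖ (1 : Matrix (Fin (a i)) (Fin (a i)) ℂ)

/-- The local signal Hamiltonian `∑ₖ h^(i,k)` of collection `i`. -/
def signal (a : Fin M → ℕ) (i : Fin M) : Matrix (S.Cell a i) (S.Cell a i) ℂ :=
  ∑ k, S.onParticle a i k (S.h i k)

/-- The raising operator `|e⟩⟨g|` of particle `(i, k)`. -/
def raising (a : Fin M → ℕ) (i : Fin M) (k : Fin N) : Matrix (S.Out a) (S.Out a) ℂ :=
  onFactor (τ := S.Cell a) i (S.onParticle a i k (Matrix.single (S.e i k) (S.g i k) 1))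

/-- The lowering operator `|g⟩⟨e|` of particle `(i, k)`. -/
def lowering (a : Fin M → ℕ) (i : Fin M) (k : Fin N) : Matrix (S.Out a) (S.Out a) ℂ :=
  onFactor (τ := S.Cell a) i (S.onParticle a i k (Matrix.single (S.g i k) (S.e i k) 1))

/-- The superradiant quantity `∑_{k ≠ l} Tr[σ D₊^(i,k) D₋^(i,l)]` of collection `i` (real, since the
operator `∑_{k ≠ l} D₊^(i,k) D₋^(i,l)` is Hermitian). -/
def superradiance (a : Fin M → ℕ) (i : Fin M) (σ : Matrix (S.Out a) (S.Out a) ℂ) : ℝ :=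
  (∑ k, ∑ l, if k ≠ l then (σ * S.raising a i k * S.lowering a i l).trace else 0).re

/-- The sum over the collections of one quarter of the quantum Fisher information and the
superradiant quantity. -/
def objective (a : Fin M → ℕ) (σ : Matrix (S.Out a) (S.Out a) ℂ) : ℝ :=
  ∑ i, ((1 / 4 : ℝ) * qfi (reduceTo (τ := S.Cell a) i σ) (S.signal a i) + S.superradiance a i σ)

variable {ι : Type} [Fintype ι] [DecidableEq ι]

/-- The values of the objective that incoherent operations can reach from `|ψ⟩`. The operation may
output any finite number of ancillary dimensions in each collection. -/
def pureValues (ψ : ι → ℂ) : Set ℝ :=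
  {v | ∃ (a : Fin M → ℕ) (Φ : Matrix ι ι ℂ → Matrix (S.Out a) (S.Out a) ℂ),
    IsICPTP Φ ∧ v = S.objective a (Φ (proj ψ))}

/-- The joint quantity of a pure state. -/
def pureCSF (ψ : ι → ℂ) : ℝ := sSup (S.pureValues ψ)

/-- The averages of the joint quantity over the pure state decompositions of `ρ`. -/
def roofValues (ρ : Matrix ι ι ℂ) : Set ℝ :=
  {v | ∃ (r : ℕ) (p : Fin r → ℝ) (ψ : Fin r → ι → ℂ),
    (∀ m, 0 ≤ p m) ∧ ∑ m, p m = 1 ∧ (∀ m, IsPure (ψ m)) ∧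
    ρ = ∑ m, p m • proj (ψ m) ∧ v = ∑ m, p m * S.pureCSF (ψ m)}

/-- The joint quantity of a mixed state, its convex roof. -/
def CSF (ρ : Matrix ι ι ℂ) : ℝ := sInf (S.roofValues ρ)

end Setup

end SFCoherence

end

set_option linter.unusedSectionVars false

noncomputable section

namespace SFCoherence

/-! ### Convex hulls of compact sets -/

/-! Both extrema are attained because they are extreme points of a fibre of a compact convex hull.
The axioms follow because the objective is sublinear on positive operators and exactly additive on
branches that carry classical flags.

For positive ρ the Fisher information is a maximum of functionals `fisherDual` linear in ρ, attained
in a compact set of operators that depends on H alone (`exists_fisherDual_eq_qfi`). Hence it is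
continuous, homogeneous and subadditive on positive operators, and additive over orthogonal blocks
respected by H (`qfi_directSum`). The superradiant term is linear. So merging the branches of an
operation never increases the objective, while writing the branch label into the ancillas of every
collection realizes the sum over branches (`sum_objective_mem_pureValues`).

An incoherent Kraus operator has at most one nonzero entry per column. From a space of dimension d
it therefore uses at most d ancilla labels in each collection, and up to relabelling there are
finitely many patterns, each with a coefficient vector. The pairs (KᴴK, value of the branch) with
unit coefficient vectors form a compact set. A complete Kraus family corresponds to a point of the
convex hull of this set above 1/d, and the maximum over operations is d times the top of that fibre
(`isGreatest_pureCSF`).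

The resulting function of vectors is homogeneous of degree two, bounded on unit vectors and lower
semicontinuous, being a maximum of continuous functions. Its truncated epigraph over the pure states
is thus compact, and the bottom of a fibre of the convex hull gives the optimal decomposition
(`isLeast_CSF`). Strong monotonicity on vectors comes from following each outcome by its own optimal
operation and flagging it (`sum_pureCSF_le`); the roof inherits this, and is convex since
decompositions can be concatenated.

Faithfulness: diagonal states stay diagonal and have objective zero. For a vector with two nonzero
amplitudes, an injective relabelling of the basis makes these two labels differ only in the energy
of one particle. The reduced state then fails to commute with the Hamiltonian, and the superradiant
term vanishes since only one particle varies (`pureCSF_pos`). -/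

theorem isCompact_convexHull_of_finiteDimensional {E : Type*} [AddCommGroup E] [Module ℝ E]
    [TopologicalSpace E] [ContinuousAdd E] [ContinuousSMul ℝ E] [FiniteDimensional ℝ E]
    {s : Set E} (hs : IsCompact s) : IsCompact (convexHull ℝ s) := by
  rcases s.eq_empty_or_nonempty with rfl | ⟨x₀, hx₀⟩
  · simp
  -- By Carathéodory, d points suffice, so the hull is the image of a simplex times d copies of s.
  -- Unused slots get weight 0 and the point x₀.
  let d := Module.finrank ℝ E + 1
  let f : (Fin d → ℝ) × (Fin d → E) → E := fun q => ∑ i, q.1 i • q.2 i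
  have hf : Continuous f := by fun_prop
  have hK : IsCompact (stdSimplex ℝ (Fin d) ×ˢ Set.univ.pi fun _ : Fin d => s) :=
    (isCompact_stdSimplex ℝ (Fin d)).prod (isCompact_univ_pi fun _ => hs)
  convert hK.image hf using 1
  apply Set.Subset.antisymm
  · intro x hx
    obtain ⟨κ, _, z, w, hz, hind, hw, hw1, hwz⟩ := eq_pos_convex_span_of_mem_convexHull hx
    have hcard : Fintype.card κ ≤ Fintype.card (Fin d) := by
      rw [Fintype.card_fin]
      exact hind.card_le_finrank_succ.trans
        (Nat.succ_le_succ (Submodule.finrank_le _))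
    obtain ⟨e⟩ := Function.Embedding.nonempty_of_card_le hcard
    have hsum : ∀ {F : Type _} [AddCommMonoid F] (g : Fin d → F) (g' : κ → F),
        (∀ k, g (e k) = g' k) → (∀ i, i ∉ Set.range e → g i = 0) → ∑ i, g i = ∑ k, g' k := by
      intro F _ g g' h1 h2
      exact (Fintype.sum_of_injective e e.injective g' g (fun i hi => h2 i hi)
        (fun k => (h1 k).symm)).symm
    refine ⟨(Function.extend e w 0, Function.extend e z fun _ => x₀), ⟨⟨?_, ?_⟩, ?_⟩, ?_⟩
    · intro i
      by_cases hi : ∃ k, e k = i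
      · obtain ⟨k, rfl⟩ := hi
        simpa [e.injective.extend_apply] using (hw k).le
      · simp [Function.extend_apply' _ _ _ hi]
    · rw [← hw1]
      apply Eq.symm
      refine Fintype.sum_of_injective e e.injective w _ (fun i hi => ?_) (fun k => ?_)
      · exact Function.extend_apply' _ _ _ hi
      · exact (e.injective.extend_apply _ _ _).symm
    · intro i _
      by_cases hi : ∃ k, e k = i
      · obtain ⟨k, rfl⟩ := hi
        simpa [e.injective.extend_apply] using hz ⟨k, rfl⟩
      · simpa [Function.extend_apply' _ _ _ hi] using hx₀
    · rw [← hwz]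
      refine (hsum _ _ (fun k => ?_) (fun i hi => ?_))
      · simp [e.injective.extend_apply]
      · simp [Function.extend_apply' w _ _ hi]
  · rintro _ ⟨⟨w, z⟩, ⟨hw, hz⟩, rfl⟩
    exact (convex_convexHull ℝ s).sum_mem (fun i _ => hw.1 i) hw.2
      (fun i _ => subset_convexHull ℝ s (hz i trivial))

/-! ### A variational formula for the quantum Fisher information -/

section Fisher

variable {ι κ : Type} [Fintype ι] [Fintype κ] [DecidableEq ι] [DecidableEq κ]

/-- The quadratic functional of `A` whose maximum is the quantum Fisher information. -/
def fisherDual (ρ H A : Matrix ι ι ℂ) : ℝ :=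
  2 * (Aᴴ * (ρ * H - H * ρ)).trace.re - 1 / 2 * (ρ * (Aᴴ * A + A * Aᴴ)).trace.re

theorem trace_unitary_conj {U : Matrix ι ι ℂ} (hU : U * star U = 1) (X : Matrix ι ι ℂ) :
    (star U * X * U).trace = X.trace := by
  rw [Matrix.trace_mul_comm, ← Matrix.mul_assoc, hU, Matrix.one_mul]

theorem fisherDual_conj {U : Matrix ι ι ℂ} (hU : U * star U = 1) (ρ H A : Matrix ι ι ℂ) :
    fisherDual (star U * ρ * U) (star U * H * U) (star U * A * U) = fisherDual ρ H A := by
  have key : ∀ X Y : Matrix ι ι ℂ,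
      (star U * X * U) * (star U * Y * U) = star U * (X * Y) * U := by
    intro X Y
    calc (star U * X * U) * (star U * Y * U) = star U * X * (U * star U) * Y * U := by
          simp only [Matrix.mul_assoc]
      _ = _ := by rw [hU]; simp only [Matrix.mul_assoc, Matrix.one_mul]
  have hA : (star U * A * U)ᴴ = star U * Aᴴ * U := by
    simp [Matrix.star_eq_conjTranspose, Matrix.conjTranspose_mul, Matrix.mul_assoc]
  have hsub : ∀ X Y : Matrix ι ι ℂ,
      star U * X * U - star U * Y * U = star U * (X - Y) * U := by
    intro X Y; rw [Matrix.mul_sub, Matrix.sub_mul]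
  have hadd : ∀ X Y : Matrix ι ι ℂ,
      star U * X * U + star U * Y * U = star U * (X + Y) * U := by
    intro X Y; rw [Matrix.mul_add, Matrix.add_mul]
  unfold fisherDual
  rw [hA]
  simp only [key, hsub, hadd, trace_unitary_conj hU]

/-- In an eigenbasis of ρ the functional decouples over the entries of A, so it can be maximized
entry by entry. -/
theorem fisherDual_diagonal (w : ι → ℝ) (H A : Matrix ι ι ℂ) :
    fisherDual (Matrix.diagonal fun i => (w i : ℂ)) H A =
      ∑ i, ∑ j, (2 * (w i - w j) * (star (A i j) * H i j).re
        - 1 / 2 * (w i + w j) * ‖A i j‖ ^ 2) := by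
  have h1 : (Aᴴ * ((Matrix.diagonal fun i => (w i : ℂ)) * H -
      H * Matrix.diagonal fun i => (w i : ℂ))).trace.re =
      ∑ i, ∑ j, (w i - w j) * (star (A i j) * H i j).re := by
    rw [Finset.sum_comm]
    simp only [Matrix.trace, Matrix.diag, Matrix.mul_apply, Complex.re_sum, Matrix.sub_apply,
      Matrix.conjTranspose_apply]
    refine Finset.sum_congr rfl fun i _ => Finset.sum_congr rfl fun j _ => ?_
    have : star (A j i) * (↑(w j) * H j i - H j i * ↑(w i)) =
      ((w j - w i : ℝ) : ℂ) * (star (A j i) * H j i) := by push_cast; ring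
    rw [← Matrix.mul_apply, ← Matrix.mul_apply, Matrix.diagonal_mul, Matrix.mul_diagonal, this,
      Complex.re_ofReal_mul]
  have h2 : ((Matrix.diagonal fun i => (w i : ℂ)) * (Aᴴ * A + A * Aᴴ)).trace.re =
      ∑ i, ∑ j, (w i + w j) * ‖A i j‖ ^ 2 := by
    have e1 : ∀ i, ((Aᴴ * A) i i).re = ∑ j, ‖A j i‖ ^ 2 := by
      intro i
      simp only [Matrix.mul_apply, Complex.re_sum, Matrix.conjTranspose_apply]
      refine Finset.sum_congr rfl fun j _ => ?_
      rw [Complex.star_def, Complex.conj_mul']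
      norm_cast
    have e2 : ∀ i, ((A * Aᴴ) i i).re = ∑ j, ‖A i j‖ ^ 2 := by
      intro i
      simp only [Matrix.mul_apply, Complex.re_sum, Matrix.conjTranspose_apply]
      refine Finset.sum_congr rfl fun j _ => ?_
      rw [Complex.star_def, Complex.mul_conj']
      norm_cast
    simp only [Matrix.trace, Matrix.diag, Complex.re_sum, Matrix.diagonal_mul,
      Complex.re_ofReal_mul, Matrix.add_apply, Complex.add_re, e1, e2, add_mul, mul_add,
      Finset.sum_add_distrib, Finset.mul_sum]
    rw [add_comm]
    congr 1
    exact Finset.sum_comm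
  unfold fisherDual
  rw [h1, h2, Finset.mul_sum, Finset.mul_sum, ← Finset.sum_sub_distrib]
  refine Finset.sum_congr rfl fun i _ => ?_
  rw [Finset.mul_sum, Finset.mul_sum, ← Finset.sum_sub_distrib]
  refine Finset.sum_congr rfl fun j _ => ?_
  ring

/-- Bound the real part by the modulus, then complete the square. If x + y = 0, both sides vanish.
-/
theorem fisherDual_term_le {x y : ℝ} (hx : 0 ≤ x) (hy : 0 ≤ y) (a h : ℂ) :
    2 * (x - y) * (star a * h).re - 1 / 2 * (x + y) * ‖a‖ ^ 2 ≤
      2 * ((x - y) ^ 2 / (x + y) * ‖h‖ ^ 2) := by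
  rcases (add_nonneg hx hy).eq_or_lt with hs | hs
  · have hx0 : x = 0 := by linarith
    have hy0 : y = 0 := by linarith
    simp [hx0, hy0]
  have h1 : (x - y) * (star a * h).re ≤ |x - y| * (‖a‖ * ‖h‖) := by
    calc (x - y) * (star a * h).re ≤ |(x - y) * (star a * h).re| := le_abs_self _
      _ = |x - y| * |(star a * h).re| := abs_mul _ _
      _ ≤ |x - y| * ‖star a * h‖ := by gcongr; exact Complex.abs_re_le_norm _
      _ = _ := by rw [norm_mul, norm_star]
  have h2 : 2 * (|x - y| * (‖a‖ * ‖h‖)) ≤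
      1 / 2 * (x + y) * ‖a‖ ^ 2 + 2 * ((x - y) ^ 2 / (x + y) * ‖h‖ ^ 2) := by
    rw [← sq_abs (x - y)]
    have : 1 / 2 * (x + y) * ‖a‖ ^ 2 + 2 * (|x - y| ^ 2 / (x + y) * ‖h‖ ^ 2) -
        2 * (|x - y| * (‖a‖ * ‖h‖)) =
        ((x + y) * ‖a‖ - 2 * |x - y| * ‖h‖) ^ 2 / (2 * (x + y)) := by
      field_simp; ring
    have h3 : 0 ≤ ((x + y) * ‖a‖ - 2 * |x - y| * ‖h‖) ^ 2 / (2 * (x + y)) := by positivity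
    linarith
  linarith

/-- The entry used here is the vertex of the quadratic; division by zero makes it 0 when x = y = 0,
which is still optimal. -/
theorem fisherDual_term_eq {x y : ℝ} (hx : 0 ≤ x) (hy : 0 ≤ y) (h : ℂ) :
    2 * (x - y) * (star (((2 * (x - y) / (x + y) : ℝ) : ℂ) * h) * h).re -
      1 / 2 * (x + y) * ‖((2 * (x - y) / (x + y) : ℝ) : ℂ) * h‖ ^ 2 =
      2 * ((x - y) ^ 2 / (x + y) * ‖h‖ ^ 2) := by
  rcases (add_nonneg hx hy).eq_or_lt with hs | hs
  · have hx0 : x = 0 := by linarith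
    have hy0 : y = 0 := by linarith
    simp [hx0, hy0]
  have h1 : (star (((2 * (x - y) / (x + y) : ℝ) : ℂ) * h) * h).re =
      2 * (x - y) / (x + y) * ‖h‖ ^ 2 := by
    rw [star_mul', Complex.star_def, Complex.conj_ofReal, mul_assoc,
      Complex.re_ofReal_mul, Complex.conj_mul']
    norm_cast
  rw [h1, norm_mul, Complex.norm_real, mul_pow, Real.norm_eq_abs, sq_abs]
  field_simp
  ring

/-- The operators `A` among which the maximum of `fisherDual` is found. -/
def fisherBall (H : Matrix ι ι ℂ) : Set (Matrix ι ι ℂ) :=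
  {A | (Aᴴ * A).trace.re ≤ 4 * (Hᴴ * H).trace.re}

theorem re_trace_conjTranspose_mul_self (A : Matrix ι κ ℂ) :
    (Aᴴ * A).trace.re = ∑ i, ∑ j, ‖A i j‖ ^ 2 := by
  rw [Finset.sum_comm]
  simp only [Matrix.trace, Matrix.diag, Matrix.mul_apply, Complex.re_sum,
    Matrix.conjTranspose_apply]
  refine Finset.sum_congr rfl fun i _ => Finset.sum_congr rfl fun j _ => ?_
  rw [Complex.star_def, Complex.conj_mul']
  norm_cast

theorem isCompact_fisherBall (H : Matrix ι ι ℂ) : IsCompact (fisherBall H) := by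
  -- The added 1 turns a bound on the square of an entry t into one on t, by 2t ≤ t² + 1.
  set R : ℝ := 4 * (Hᴴ * H).trace.re + 1 with hR
  have hH : 0 ≤ (Hᴴ * H).trace.re := by
    rw [re_trace_conjTranspose_mul_self]; positivity
  have hbox : IsCompact (Set.univ.pi fun _ : ι => Set.univ.pi fun _ : ι =>
      Metric.closedBall (0 : ℂ) R) :=
    isCompact_univ_pi fun _ => isCompact_univ_pi fun _ => isCompact_closedBall _ _
  have hclosed : IsClosed (fisherBall H) := by
    have h : Continuous fun A : Matrix ι ι ℂ => (Aᴴ * A).trace.re := by fun_prop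
    exact isClosed_le h continuous_const
  refine hbox.of_isClosed_subset hclosed fun (A : Matrix ι ι ℂ) hA i _ j _ => ?_
  rw [mem_closedBall_zero_iff]
  have h1 : ‖A i j‖ ^ 2 ≤ (Aᴴ * A).trace.re := by
    rw [re_trace_conjTranspose_mul_self]
    refine le_trans ?_ (Finset.single_le_sum (f := fun i => ∑ j, ‖A i j‖ ^ 2)
      (fun i _ => by positivity) (Finset.mem_univ i))
    exact Finset.single_le_sum (f := fun j => ‖A i j‖ ^ 2)
      (fun i _ => by positivity) (Finset.mem_univ j)
  have h2 : ‖A i j‖ ^ 2 ≤ 4 * (Hᴴ * H).trace.re := h1.trans hA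
  nlinarith [norm_nonneg (A i j), sq_nonneg (‖A i j‖ - 1)]

theorem qfi_eq_of_isHermitian {ρ : Matrix ι ι ℂ} (hρ : ρ.IsHermitian) (H : Matrix ι ι ℂ) :
    qfi ρ H = 2 * ∑ i, ∑ j, (hρ.eigenvalues i - hρ.eigenvalues j) ^ 2 /
        (hρ.eigenvalues i + hρ.eigenvalues j) *
      ‖(star (hρ.eigenvectorUnitary : Matrix ι ι ℂ) * H *
        (hρ.eigenvectorUnitary : Matrix ι ι ℂ)) i j‖ ^ 2 := by
  unfold qfi
  rw [dif_pos hρ]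

theorem star_eigenvectorUnitary_mul_mul {ρ : Matrix ι ι ℂ} (hρ : ρ.IsHermitian) :
    star (hρ.eigenvectorUnitary : Matrix ι ι ℂ) * ρ * (hρ.eigenvectorUnitary : Matrix ι ι ℂ) =
      Matrix.diagonal fun i => (hρ.eigenvalues i : ℂ) := by
  have h := hρ.conjStarAlgAut_star_eigenvectorUnitary
  rw [Unitary.conjStarAlgAut_star_apply] at h
  exact h

theorem fisherDual_le_qfi {ρ : Matrix ι ι ℂ} (hρ : ρ.PosSemidef) (H A : Matrix ι ι ℂ) :
    fisherDual ρ H A ≤ qfi ρ H := by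
  rw [qfi_eq_of_isHermitian hρ.isHermitian, ← fisherDual_conj
    (Unitary.mul_star_self_of_mem hρ.isHermitian.eigenvectorUnitary.2),
    star_eigenvectorUnitary_mul_mul, fisherDual_diagonal, Finset.mul_sum]
  refine Finset.sum_le_sum fun i _ => ?_
  rw [Finset.mul_sum]
  refine Finset.sum_le_sum fun j _ => ?_
  exact fisherDual_term_le (hρ.eigenvalues_nonneg i) (hρ.eigenvalues_nonneg j) _ _

/-- The maximizer is, up to a phase, the symmetric logarithmic derivative: in the eigenbasis it
multiplies the entries of H by factors of modulus at most 2. This puts it in a ball independent of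
ρ, as continuity in ρ requires. -/
theorem exists_fisherDual_eq_qfi {ρ : Matrix ι ι ℂ} (hρ : ρ.PosSemidef) (H : Matrix ι ι ℂ) :
    ∃ A ∈ fisherBall H, fisherDual ρ H A = qfi ρ H := by
  set U : Matrix ι ι ℂ := (hρ.isHermitian.eigenvectorUnitary : Matrix ι ι ℂ) with hUdef
  set w := hρ.isHermitian.eigenvalues with hw
  have hU : U * star U = 1 := Unitary.mul_star_self_of_mem hρ.isHermitian.eigenvectorUnitary.2
  have hU' : star U * U = 1 := Unitary.star_mul_self_of_mem hρ.isHermitian.eigenvectorUnitary.2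
  let B : Matrix ι ι ℂ := Matrix.of fun i j =>
    ((2 * (w i - w j) / (w i + w j) : ℝ) : ℂ) * (star U * H * U) i j
  have hB : star U * (U * B * star U) * U = B := by
    calc star U * (U * B * star U) * U = (star U * U) * B * (star U * U) := by
          simp only [Matrix.mul_assoc]
      _ = B := by rw [hU']; simp
  have htr : ∀ X : Matrix ι ι ℂ,
      ((star U * X * U)ᴴ * (star U * X * U)).trace = (Xᴴ * X).trace := by
    intro X
    rw [← trace_unitary_conj hU (Xᴴ * X)]
    congr 1
    calc (star U * X * U)ᴴ * (star U * X * U) = star U * Xᴴ * (U * star U) * X * U := by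
          simp [Matrix.star_eq_conjTranspose, Matrix.conjTranspose_mul, Matrix.mul_assoc]
      _ = _ := by rw [hU]; simp only [Matrix.mul_assoc, Matrix.mul_one]
  refine ⟨U * B * star U, ?_, ?_⟩
  · change ((U * B * star U)ᴴ * (U * B * star U)).trace.re ≤ 4 * (Hᴴ * H).trace.re
    rw [← htr (U * B * star U), hB, ← htr H, re_trace_conjTranspose_mul_self,
      re_trace_conjTranspose_mul_self, Finset.mul_sum]
    refine Finset.sum_le_sum fun i _ => ?_
    rw [Finset.mul_sum]
    refine Finset.sum_le_sum fun j _ => ?_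
    have hi : 0 ≤ w i := hρ.eigenvalues_nonneg i
    have hj : 0 ≤ w j := hρ.eigenvalues_nonneg j
    have hle : (2 * (w i - w j) / (w i + w j)) ^ 2 ≤ 4 := by
      rw [div_pow]
      refine div_le_of_le_mul₀ (by positivity) (by norm_num) ?_
      nlinarith [mul_nonneg hi hj]
    simp only [B, Matrix.of_apply, norm_mul, Complex.norm_real, mul_pow, Real.norm_eq_abs, sq_abs]
    gcongr
  · rw [qfi_eq_of_isHermitian hρ.isHermitian, ← fisherDual_conj hU, hB,
      star_eigenvectorUnitary_mul_mul, fisherDual_diagonal, Finset.mul_sum]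
    refine Finset.sum_congr rfl fun i _ => ?_
    rw [Finset.mul_sum]
    refine Finset.sum_congr rfl fun j _ => ?_
    exact fisherDual_term_eq (hρ.eigenvalues_nonneg i) (hρ.eigenvalues_nonneg j) _

/-! ### Consequences: continuity, subadditivity, homogeneity, faithfulness -/

/-- A supremum over a fixed compact set of a jointly continuous function is continuous. The
auxiliary g avoids the default value of `qfi` at non-Hermitian matrices. -/
theorem exists_continuous_eq_qfi (H : Matrix ι ι ℂ) :
    ∃ g : Matrix ι ι ℂ → ℝ, Continuous g ∧ ∀ ρ, ρ.PosSemidef → qfi ρ H = g ρ := by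
  refine ⟨fun ρ => sSup ((fun A => fisherDual ρ H A) '' fisherBall H),
    (isCompact_fisherBall H).continuous_sSup ?_, fun ρ hρ => ?_⟩
  · unfold fisherDual
    simp only [Function.HasUncurry.uncurry, id]
    fun_prop
  · obtain ⟨A, hA, hAq⟩ := exists_fisherDual_eq_qfi hρ H
    have hg : IsGreatest ((fun A => fisherDual ρ H A) '' fisherBall H) (qfi ρ H) := by
      refine ⟨⟨A, hA, hAq⟩, ?_⟩
      rintro _ ⟨B, -, rfl⟩
      exact fisherDual_le_qfi hρ H B
    exact hg.csSup_eq.symm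

theorem fisherDual_sum {ν : Type*} (s : Finset ν) (ρ : ν → Matrix ι ι ℂ) (H A : Matrix ι ι ℂ) :
    fisherDual (∑ n ∈ s, ρ n) H A = ∑ n ∈ s, fisherDual (ρ n) H A := by
  simp only [fisherDual, Finset.sum_mul, Finset.mul_sum, Matrix.trace_sum, Complex.re_sum,
    ← Finset.sum_sub_distrib]

theorem fisherDual_smul (c : ℝ) (ρ H A : Matrix ι ι ℂ) :
    fisherDual (c • ρ) H A = c * fisherDual ρ H A := by
  simp only [fisherDual, Matrix.smul_mul, Matrix.mul_smul, ← smul_sub, Matrix.trace_smul,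
    Complex.smul_re, smul_eq_mul]
  ring

/-- The optimal A for the sum is a candidate for every summand, and `fisherDual` is additive in the
state. -/
theorem qfi_sum_le {ν : Type*} (s : Finset ν) {ρ : ν → Matrix ι ι ℂ}
    (hρ : ∀ n ∈ s, (ρ n).PosSemidef) (H : Matrix ι ι ℂ) :
    qfi (∑ n ∈ s, ρ n) H ≤ ∑ n ∈ s, qfi (ρ n) H := by
  obtain ⟨A, -, hA⟩ := exists_fisherDual_eq_qfi (Matrix.posSemidef_sum s hρ) H
  rw [← hA, fisherDual_sum]
  exact Finset.sum_le_sum fun n hn => fisherDual_le_qfi (hρ n hn) H A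

theorem qfi_nonneg {ρ : Matrix ι ι ℂ} (hρ : ρ.PosSemidef) (H : Matrix ι ι ℂ) : 0 ≤ qfi ρ H := by
  refine le_trans ?_ (fisherDual_le_qfi hρ H 0)
  simp [fisherDual]

theorem qfi_smul {ρ : Matrix ι ι ℂ} (hρ : ρ.PosSemidef) (H : Matrix ι ι ℂ) {c : ℝ} (hc : 0 ≤ c) :
    qfi (c • ρ) H = c * qfi ρ H := by
  have hcρ : (c • ρ).PosSemidef := hρ.smul hc
  apply le_antisymm
  · obtain ⟨A, -, hA⟩ := exists_fisherDual_eq_qfi hcρ H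
    rw [← hA, fisherDual_smul]
    exact mul_le_mul_of_nonneg_left (fisherDual_le_qfi hρ H A) hc
  · obtain ⟨A, -, hA⟩ := exists_fisherDual_eq_qfi hρ H
    rw [← hA, ← fisherDual_smul]
    exact fisherDual_le_qfi hcρ H A

theorem re_trace_mul_mul_conjTranspose_nonneg {ρ : Matrix ι ι ℂ} (hρ : ρ.PosSemidef)
    (C : Matrix κ ι ℂ) : 0 ≤ (C * ρ * Cᴴ).trace.re :=
  (Complex.nonneg_iff.1 (hρ.mul_mul_conjTranspose_same C).trace_nonneg).1

/-- The linear term of `fisherDual` vanishes and the quadratic one is never positive. -/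
theorem qfi_eq_zero_of_commute {ρ : Matrix ι ι ℂ} (hρ : ρ.PosSemidef) {H : Matrix ι ι ℂ}
    (h : ρ * H = H * ρ) : qfi ρ H = 0 := by
  refine le_antisymm ?_ (qfi_nonneg hρ H)
  obtain ⟨A, -, hA⟩ := exists_fisherDual_eq_qfi hρ H
  have h1 := re_trace_mul_mul_conjTranspose_nonneg hρ A
  have h2 := re_trace_mul_mul_conjTranspose_nonneg hρ Aᴴ
  have e1 : (ρ * (Aᴴ * A + A * Aᴴ)).trace = (A * ρ * Aᴴ).trace + (Aᴴ * ρ * Aᴴᴴ).trace := by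
    rw [Matrix.mul_add, Matrix.trace_add, Matrix.conjTranspose_conjTranspose,
      Matrix.trace_mul_cycle A ρ, Matrix.trace_mul_cycle Aᴴ ρ, Matrix.trace_mul_comm ρ,
      Matrix.trace_mul_comm ρ]
  rw [← hA, fisherDual, h, sub_self, Matrix.mul_zero, Matrix.trace_zero, e1, Complex.add_re]
  simp only [Complex.zero_re, mul_zero, zero_sub]
  linarith

/-- Every term of the spectral sum vanishes, so H has no entry between distinct eigenvalues. A
vanishing denominator forces both eigenvalues to be 0, hence equal. -/
theorem commute_of_qfi_eq_zero {ρ : Matrix ι ι ℂ} (hρ : ρ.PosSemidef) {H : Matrix ι ι ℂ}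
    (h : qfi ρ H = 0) : ρ * H = H * ρ := by
  set U : Matrix ι ι ℂ := (hρ.isHermitian.eigenvectorUnitary : Matrix ι ι ℂ) with hUdef
  set w := hρ.isHermitian.eigenvalues with hw
  have hU : U * star U = 1 := Unitary.mul_star_self_of_mem hρ.isHermitian.eigenvectorUnitary.2
  have hU' : star U * U = 1 := Unitary.star_mul_self_of_mem hρ.isHermitian.eigenvectorUnitary.2
  have hw0 : ∀ i, 0 ≤ w i := hρ.eigenvalues_nonneg
  have hD := star_eigenvectorUnitary_mul_mul hρ.isHermitian
  rw [← hUdef, ← hw] at hD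
  rw [qfi_eq_of_isHermitian hρ.isHermitian, mul_eq_zero_iff_left (by norm_num),
    Finset.sum_eq_zero_iff_of_nonneg
      (fun i _ => Finset.sum_nonneg fun j _ => mul_nonneg
        (div_nonneg (sq_nonneg _) (add_nonneg (hw0 i) (hw0 j))) (sq_nonneg _))] at h
  have hterm : ∀ i j, ((w i : ℂ) - w j) * (star U * H * U) i j = 0 := by
    intro i j
    have h1 := h i (Finset.mem_univ i)
    rw [Finset.sum_eq_zero_iff_of_nonneg (fun j _ => mul_nonneg
        (div_nonneg (sq_nonneg _) (add_nonneg (hw0 i) (hw0 j))) (sq_nonneg _))] at h1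
    have h2 := h1 j (Finset.mem_univ j)
    rcases mul_eq_zero.1 h2 with h3 | h3
    · have : w i = w j := by
        rcases div_eq_zero_iff.1 h3 with h4 | h4
        · exact sub_eq_zero.1 (pow_eq_zero_iff (two_ne_zero) |>.1 h4)
        · have a1 := hw0 i
          have a2 := hw0 j
          change w i + w j = 0 at h4
          linarith
      rw [this, sub_self, zero_mul]
    · rw [norm_eq_zero.1 (pow_eq_zero_iff (two_ne_zero) |>.1 h3), mul_zero]
  have hcomm : (star U * ρ * U) * (star U * H * U) = (star U * H * U) * (star U * ρ * U) := by
    rw [hD]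
    ext i j
    rw [Matrix.diagonal_mul, Matrix.mul_diagonal]
    have := hterm i j
    rw [sub_mul, sub_eq_zero] at this
    rw [this, mul_comm]
  have back : ∀ X Y : Matrix ι ι ℂ,
      U * ((star U * X * U) * (star U * Y * U)) * star U = X * Y := by
    intro X Y
    calc U * ((star U * X * U) * (star U * Y * U)) * star U
        = (U * star U) * X * (U * star U) * Y * (U * star U) := by simp only [Matrix.mul_assoc]
      _ = X * Y := by rw [hU]; simp
  rw [← back ρ H, hcomm, back]

/-! ### Direct sums -/

/-- Since W intertwines the Hamiltonians, the linear term sees only the compression of A. The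
quadratic term also charges for the parts of AW and AᴴW outside the range of W. -/
theorem fisherDual_isometry_conj {W : Matrix κ ι ℂ} (hW : Wᴴ * W = 1) {H : Matrix κ κ ℂ}
    (hH : H.IsHermitian) {H' : Matrix ι ι ℂ} (hH' : H'.IsHermitian) (hHW : H * W = W * H')
    (ρ : Matrix ι ι ℂ) (A : Matrix κ κ ℂ) :
    fisherDual (W * ρ * Wᴴ) H A = fisherDual ρ H' (Wᴴ * A * W) -
      1 / 2 * (((1 - W * Wᴴ) * A * W * ρ * ((1 - W * Wᴴ) * A * W)ᴴ).trace.re +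
        ((1 - W * Wᴴ) * Aᴴ * W * ρ * ((1 - W * Wᴴ) * Aᴴ * W)ᴴ).trace.re) := by
  have hWH : Wᴴ * H = H' * Wᴴ := by
    have := congrArg Matrix.conjTranspose hHW
    rwa [Matrix.conjTranspose_mul, Matrix.conjTranspose_mul, hH.eq, hH'.eq] at this
  have h1 : (Aᴴ * (W * ρ * Wᴴ * H - H * (W * ρ * Wᴴ))).trace =
      ((Wᴴ * A * W)ᴴ * (ρ * H' - H' * ρ)).trace := by
    have : W * ρ * Wᴴ * H - H * (W * ρ * Wᴴ) = W * (ρ * H' - H' * ρ) * Wᴴ := by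
      rw [Matrix.mul_assoc, hWH, ← Matrix.mul_assoc H, ← Matrix.mul_assoc H, hHW]
      simp only [Matrix.mul_sub, Matrix.sub_mul, Matrix.mul_assoc]
    rw [this, ← Matrix.mul_assoc, Matrix.trace_mul_comm, ← Matrix.mul_assoc, ← Matrix.mul_assoc]
    simp only [Matrix.conjTranspose_mul, Matrix.conjTranspose_conjTranspose, Matrix.mul_assoc]
  have hP : (1 - W * Wᴴ)ᴴ * (1 - W * Wᴴ) = 1 - W * Wᴴ := by
    have : W * Wᴴ * (W * Wᴴ) = W * Wᴴ := by
      calc W * Wᴴ * (W * Wᴴ) = W * (Wᴴ * W) * Wᴴ := by simp only [Matrix.mul_assoc]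
        _ = _ := by rw [hW, Matrix.mul_one]
    simp [Matrix.conjTranspose_sub, Matrix.conjTranspose_mul, Matrix.mul_sub, Matrix.sub_mul, this]
  have h2 : ∀ B : Matrix κ κ ℂ, (W * ρ * Wᴴ * (Bᴴ * B)).trace =
      (ρ * ((Wᴴ * B * W)ᴴ * (Wᴴ * B * W))).trace +
        ((1 - W * Wᴴ) * B * W * ρ * ((1 - W * Wᴴ) * B * W)ᴴ).trace := by
    intro B
    have e1 : ((1 - W * Wᴴ) * B * W * ρ * ((1 - W * Wᴴ) * B * W)ᴴ).trace =
        (ρ * (Wᴴ * Bᴴ * ((1 - W * Wᴴ)ᴴ * (1 - W * Wᴴ)) * B * W)).trace := by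
      rw [Matrix.mul_assoc, Matrix.trace_mul_comm, Matrix.mul_assoc]
      simp only [Matrix.conjTranspose_mul, Matrix.mul_assoc]
    have e2 : (W * ρ * Wᴴ * (Bᴴ * B)).trace = (ρ * (Wᴴ * Bᴴ * B * W)).trace := by
      rw [Matrix.mul_assoc, Matrix.mul_assoc, Matrix.trace_mul_comm]
      simp only [Matrix.mul_assoc]
    rw [e1, hP, e2, ← Matrix.trace_add, ← Matrix.mul_add]
    congr 2
    simp only [Matrix.conjTranspose_mul, Matrix.conjTranspose_conjTranspose, Matrix.mul_sub,
      Matrix.sub_mul, Matrix.mul_one, Matrix.mul_assoc]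
    abel
  have h3 := h2 Aᴴ
  have hA' : Wᴴ * Aᴴ * W = (Wᴴ * A * W)ᴴ := by
    simp [Matrix.conjTranspose_mul, Matrix.mul_assoc]
  rw [hA', Matrix.conjTranspose_conjTranspose, Matrix.conjTranspose_conjTranspose] at h3
  unfold fisherDual
  rw [h1, Matrix.mul_add, Matrix.trace_add, h2 A, h3, Matrix.mul_add, Matrix.trace_add]
  simp only [Complex.add_re]
  ring

theorem fisherDual_isometry_conj_le {W : Matrix κ ι ℂ} (hW : Wᴴ * W = 1) {H : Matrix κ κ ℂ}
    (hH : H.IsHermitian) {H' : Matrix ι ι ℂ} (hH' : H'.IsHermitian) (hHW : H * W = W * H')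
    {ρ : Matrix ι ι ℂ} (hρ : ρ.PosSemidef) (A : Matrix κ κ ℂ) :
    fisherDual (W * ρ * Wᴴ) H A ≤ fisherDual ρ H' (Wᴴ * A * W) := by
  rw [fisherDual_isometry_conj hW hH hH' hHW]
  have h1 := re_trace_mul_mul_conjTranspose_nonneg hρ ((1 - W * Wᴴ) * A * W)
  have h2 := re_trace_mul_mul_conjTranspose_nonneg hρ ((1 - W * Wᴴ) * Aᴴ * W)
  linarith

/-- The quantum Fisher information is additive over orthogonal blocks that the Hamiltonian
respects. -/
theorem qfi_directSum {ν : Type} [Fintype ν] [DecidableEq ν] {γ : ν → Type} [∀ n, Fintype (γ n)]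
    [∀ n, DecidableEq (γ n)] {W : ∀ n, Matrix κ (γ n) ℂ} (hW : ∀ n, (W n)ᴴ * W n = 1)
    (hWW : ∀ n m, n ≠ m → (W n)ᴴ * W m = 0) {H : Matrix κ κ ℂ} (hH : H.IsHermitian)
    {H' : ∀ n, Matrix (γ n) (γ n) ℂ} (hH' : ∀ n, (H' n).IsHermitian)
    (hHW : ∀ n, H * W n = W n * H' n) {ρ : ∀ n, Matrix (γ n) (γ n) ℂ}
    (hρ : ∀ n, (ρ n).PosSemidef) :
    qfi (∑ n, W n * ρ n * (W n)ᴴ) H = ∑ n, qfi (ρ n) (H' n) := by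
  have hpos : (∑ n, W n * ρ n * (W n)ᴴ).PosSemidef :=
    Matrix.posSemidef_sum _ fun n _ => (hρ n).mul_mul_conjTranspose_same (W n)
  apply le_antisymm
  -- Compressing a global optimizer to each block gives candidates there, at no loss.
  · obtain ⟨A, -, hA⟩ := exists_fisherDual_eq_qfi hpos H
    rw [← hA, fisherDual_sum]
    exact Finset.sum_le_sum fun n _ =>
      (fisherDual_isometry_conj_le (hW n) hH (hH' n) (hHW n) (hρ n) A).trans
        (fisherDual_le_qfi (hρ n) _ _)
  -- The block-diagonal sum of the local optimizers preserves each block, so the correction terms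
  -- vanish.
  · choose B _ hB using fun n => exists_fisherDual_eq_qfi (hρ n) (H' n)
    set A := ∑ n, W n * B n * (W n)ᴴ with hAdef
    have hAW : ∀ n, A * W n = W n * B n := by
      intro n
      rw [hAdef, Matrix.sum_mul, Finset.sum_eq_single n]
      · rw [Matrix.mul_assoc, hW, Matrix.mul_one]
      · intro m _ hmn
        rw [Matrix.mul_assoc, hWW m n hmn, Matrix.mul_zero]
      · simp
    have hA'W : ∀ n, Aᴴ * W n = W n * (B n)ᴴ := by
      intro n
      rw [hAdef, Matrix.conjTranspose_sum, Matrix.sum_mul, Finset.sum_eq_single n]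
      · simp only [Matrix.conjTranspose_mul, Matrix.conjTranspose_conjTranspose]
        rw [Matrix.mul_assoc, Matrix.mul_assoc, hW, Matrix.mul_one]
      · intro m _ hmn
        simp only [Matrix.conjTranspose_mul, Matrix.conjTranspose_conjTranspose]
        rw [Matrix.mul_assoc, Matrix.mul_assoc, hWW m n hmn, Matrix.mul_zero, Matrix.mul_zero]
      · simp
    have hproj : ∀ n, (1 - W n * (W n)ᴴ) * W n = 0 := by
      intro n
      rw [Matrix.sub_mul, Matrix.one_mul, Matrix.mul_assoc, hW, Matrix.mul_one, sub_self]
    refine le_trans (le_of_eq ?_) (fisherDual_le_qfi hpos H A)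
    rw [fisherDual_sum]
    refine Finset.sum_congr rfl fun n _ => ?_
    rw [fisherDual_isometry_conj (hW n) hH (hH' n) (hHW n)]
    have z1 : (1 - W n * (W n)ᴴ) * A * W n = 0 := by
      rw [Matrix.mul_assoc, hAW, ← Matrix.mul_assoc, hproj, Matrix.zero_mul]
    have z2 : (1 - W n * (W n)ᴴ) * Aᴴ * W n = 0 := by
      rw [Matrix.mul_assoc, hA'W, ← Matrix.mul_assoc, hproj, Matrix.zero_mul]
    have z3 : (W n)ᴴ * A * W n = B n := by
      rw [Matrix.mul_assoc, hAW, ← Matrix.mul_assoc, hW, Matrix.one_mul]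
    rw [z1, z2, z3, hB]
    simp

end Fisher

/-! ### Isometries permuting basis vectors -/

section FunMat

variable {α β γ : Type} [Fintype α] [Fintype β] [Fintype γ] [DecidableEq α] [DecidableEq β]
  [DecidableEq γ]

/-- The linear map sending the basis vector `x` to the basis vector `f x`. -/
def funMat (f : α → β) : Matrix β α ℂ := Matrix.of fun y x => if y = f x then 1 else 0

theorem mul_funMat_apply (X : Matrix γ β ℂ) (f : α → β) (z : γ) (x : α) :
    (X * funMat f) z x = X z (f x) := by
  simp [Matrix.mul_apply, funMat]

theorem conjTranspose_funMat_mul_apply (f : α → β) (X : Matrix β γ ℂ) (x : α) (z : γ) :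
    ((funMat f)ᴴ * X) x z = X (f x) z := by
  simp [Matrix.mul_apply, funMat, Matrix.conjTranspose_apply, apply_ite star]

theorem conjTranspose_funMat_mul_mul (f : α → β) (X : Matrix β β ℂ) :
    (funMat f)ᴴ * X * funMat f = X.submatrix f f := by
  ext x y
  rw [mul_funMat_apply, conjTranspose_funMat_mul_apply, Matrix.submatrix_apply]

theorem conjTranspose_funMat_mul_self {f : α → β} (hf : Function.Injective f) :
    (funMat f)ᴴ * funMat f = 1 := by
  ext x y
  rw [mul_funMat_apply, Matrix.conjTranspose_apply, funMat, Matrix.of_apply, Matrix.one_apply]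
  by_cases h : x = y
  · simp [h]
  · have : f y ≠ f x := fun h' => h (hf h').symm
    simp [h, this]

theorem conjTranspose_funMat_mul_of_disjoint {f : α → β} {g : γ → β} (h : ∀ x y, f x ≠ g y) :
    (funMat f)ᴴ * funMat g = 0 := by
  ext x y
  rw [mul_funMat_apply, Matrix.conjTranspose_apply, funMat, Matrix.of_apply]
  simp [(h x y).symm]

theorem one_kronecker_funMat (f : α → β) :
    (1 : Matrix γ γ ℂ) ⊗ₖ funMat f = funMat (Prod.map id f) := by
  ext ⟨p, y⟩ ⟨q, x⟩
  simp only [Matrix.kroneckerMap_apply, funMat, Matrix.of_apply, Matrix.one_apply, Prod.map_apply,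
    id, Prod.mk.injEq]
  split_ifs <;> simp_all

theorem kronecker_one_mul_funMat (f : α → β) (A : Matrix γ γ ℂ) :
    (A ⊗ₖ (1 : Matrix β β ℂ)) * (funMat (Prod.map id f) : Matrix (γ × β) (γ × α) ℂ) =
      (funMat (Prod.map id f) : Matrix (γ × β) (γ × α) ℂ) * (A ⊗ₖ (1 : Matrix α α ℂ)) := by
  rw [← one_kronecker_funMat, ← Matrix.mul_kronecker_mul, ← Matrix.mul_kronecker_mul]
  simp

end FunMat

/-! ### Operators on a factor and partial traces -/

section Composite

variable {I : Type} [Fintype I] [DecidableEq I] {τ τ' : I → Type} [∀ i, Fintype (τ i)]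
  [∀ i, DecidableEq (τ i)] [∀ i, Fintype (τ' i)] [∀ i, DecidableEq (τ' i)]

theorem sum_ite_agree {E : Type*} [AddCommMonoid E] (i : I) (x : ∀ j, τ j)
    (f : (∀ j, τ j) → E) :
    ∑ z, (if ∀ j, j ≠ i → x j = z j then f z else 0) = ∑ c, f (Function.update x i c) := by
  rw [← Finset.sum_filter]
  refine Finset.sum_bij' (fun z _ => z i) (fun c _ => Function.update x i c)
    (fun _ _ => Finset.mem_univ _) (fun c _ => ?_) (fun z hz => ?_) (fun c _ => ?_)
    (fun z hz => ?_)
  · simp only [Finset.mem_filter, Finset.mem_univ, true_and]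
    intro j hj
    rw [Function.update_of_ne hj]
  · simp only [Finset.mem_filter, Finset.mem_univ, true_and] at hz
    funext j
    by_cases hj : j = i
    · subst hj; simp
    · rw [Function.update_of_ne hj, hz j hj]
  · simp
  · simp only [Finset.mem_filter, Finset.mem_univ, true_and] at hz
    congr 1
    funext j
    by_cases hj : j = i
    · subst hj; simp
    · rw [Function.update_of_ne hj, hz j hj]

theorem of_onFactor_single_apply_ne_zero {i : I} {u v : τ i} {x y : ∀ j, τ j}
    (h : onFactor i (Matrix.single u v (1 : ℂ)) x y ≠ 0) :
    x i = u ∧ y i = v ∧ ∀ j, j ≠ i → x j = y j := by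
  simp only [onFactor, Matrix.of_apply, Matrix.single_apply] at h
  split_ifs at h with h1 h2
  · exact ⟨h2.1.symm, h2.2.symm, h1⟩
  · exact absurd rfl h
  · exact absurd rfl h

theorem onFactor_mul (i : I) (A B : Matrix (τ i) (τ i) ℂ) :
    onFactor i A * onFactor i B = onFactor i (A * B) := by
  ext x y
  simp only [Matrix.mul_apply, onFactor, Matrix.of_apply, ite_mul, zero_mul]
  rw [sum_ite_agree]
  simp only [Function.update_self]
  have : ∀ c, (∀ j, j ≠ i → Function.update x i c j = y j) ↔ ∀ j, j ≠ i → x j = y j := by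
    intro c
    refine forall_congr' fun j => imp_congr_right fun hj => ?_
    rw [Function.update_of_ne hj]
  simp only [this]
  split_ifs with h
  · rfl
  · simp

/-- The partial trace is dual to `onFactor`; testing against all B then yields linearity and
compatibility with embeddings. -/
theorem trace_reduceTo_mul (i : I) (σ : Matrix (∀ j, τ j) (∀ j, τ j) ℂ)
    (B : Matrix (τ i) (τ i) ℂ) : (reduceTo i σ * B).trace = (σ * onFactor i B).trace := by
  simp only [Matrix.trace, Matrix.diag, Matrix.mul_apply, reduceTo, onFactor, Matrix.of_apply,
    mul_ite, mul_zero, Finset.sum_mul, ite_mul, zero_mul]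
  have h1 : ∀ z : ∀ j, τ j, ∑ y, (if ∀ j, j ≠ i → y j = z j then σ z y * B (y i) (z i) else 0) =
      ∑ b, σ z (Function.update z i b) * B b (z i) := by
    intro z
    have := sum_ite_agree i z fun y => σ z y * B (y i) (z i)
    simp only [Function.update_self] at this
    rw [← this]
    refine Finset.sum_congr rfl fun y _ => ?_
    simp only [eq_comm]
  simp only [h1]
  have h2 : ∀ a : τ i, ∑ b, ∑ z : ∀ j, τ j,
      (if z i = a then σ z (Function.update z i b) * B b a else 0) =
      ∑ z : ∀ j, τ j, if z i = a then ∑ b, σ z (Function.update z i b) * B b (z i) else 0 := by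
    intro a
    rw [Finset.sum_comm]
    refine Finset.sum_congr rfl fun z _ => ?_
    split_ifs with h
    · subst h; rfl
    · simp
  simp only [h2]
  rw [Finset.sum_comm]
  simp

theorem reduceTo_sum (i : I) {ν : Type*} (s : Finset ν)
    (σ : ν → Matrix (∀ j, τ j) (∀ j, τ j) ℂ) :
    reduceTo i (∑ n ∈ s, σ n) = ∑ n ∈ s, reduceTo i (σ n) := by
  rw [Matrix.ext_iff_trace_mul_right]
  intro B
  rw [trace_reduceTo_mul, Matrix.sum_mul, Matrix.sum_mul, Matrix.trace_sum, Matrix.trace_sum]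
  exact Finset.sum_congr rfl fun n _ => (trace_reduceTo_mul i _ B).symm

theorem reduceTo_smul (i : I) (c : ℝ) (σ : Matrix (∀ j, τ j) (∀ j, τ j) ℂ) :
    reduceTo i (c • σ) = c • reduceTo i σ := by
  rw [Matrix.ext_iff_trace_mul_right]
  intro B
  rw [trace_reduceTo_mul, Matrix.smul_mul, Matrix.smul_mul, Matrix.trace_smul, Matrix.trace_smul,
    trace_reduceTo_mul]

theorem continuous_reduceTo (i : I) :
    Continuous (reduceTo i : Matrix (∀ j, τ j) (∀ j, τ j) ℂ → Matrix (τ i) (τ i) ℂ) := by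
  refine continuous_matrix fun a b => ?_
  simp only [reduceTo, Matrix.of_apply]
  refine continuous_finsetSum _ fun z _ => ?_
  split_ifs
  · fun_prop
  · fun_prop

theorem posSemidef_reduceTo (i : I) {σ : Matrix (∀ j, τ j) (∀ j, τ j) ℂ} (hσ : σ.PosSemidef) :
    (reduceTo i σ).PosSemidef := by
  rcases isEmpty_or_nonempty (τ i) with h | ⟨⟨c⟩⟩
  · have : reduceTo i σ = 0 := by ext a; exact h.elim a
    rw [this]; exact Matrix.PosSemidef.zero
  -- The partial trace is a sum of principal blocks, one for each configuration of the other
  -- factors; fixing coordinate i to c picks one representative of each.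
  have key : reduceTo i σ = ∑ s ∈ Finset.univ.filter (fun s : ∀ j, τ j => s i = c),
      σ.submatrix (Function.update s i) (Function.update s i) := by
    ext a b
    rw [Matrix.sum_apply]
    simp only [reduceTo, Matrix.of_apply, Matrix.submatrix_apply]
    rw [← Finset.sum_filter]
    refine Finset.sum_bij' (fun z _ => Function.update z i c) (fun s _ => Function.update s i a)
      (fun z _ => by simp) (fun s _ => by simp) (fun z hz => ?_) (fun s hs => ?_) (fun z hz => ?_)
    · simp only [Finset.mem_filter, Finset.mem_univ, true_and] at hz
      subst hz; simp
    · simp only [Finset.mem_filter, Finset.mem_univ, true_and] at hs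
      subst hs; simp
    · simp only [Finset.mem_filter, Finset.mem_univ, true_and] at hz
      subst hz; simp
  rw [key]
  exact Matrix.posSemidef_sum _ fun s _ => hσ.submatrix _

theorem onFactor_submatrix {w : ∀ j, τ' j → τ j} (hw : ∀ j, Function.Injective (w j)) (i : I)
    (B : Matrix (τ i) (τ i) ℂ) :
    (onFactor i B).submatrix (fun x j => w j (x j)) (fun x j => w j (x j)) =
      onFactor i (B.submatrix (w i) (w i)) := by
  ext x y
  simp only [onFactor, Matrix.submatrix_apply, Matrix.of_apply, (hw _).eq_iff]

theorem reduceTo_funMat_conj {w : ∀ j, τ' j → τ j} (hw : ∀ j, Function.Injective (w j)) (i : I)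
    (σ : Matrix (∀ j, τ' j) (∀ j, τ' j) ℂ) :
    reduceTo i (funMat (fun (x : ∀ j, τ' j) j => w j (x j)) * σ *
      (funMat (fun (x : ∀ j, τ' j) j => w j (x j)))ᴴ) =
      funMat (w i) * reduceTo i σ * (funMat (w i))ᴴ := by
  rw [Matrix.ext_iff_trace_mul_right]
  intro B
  have hcyc : ∀ {α β : Type} [Fintype α] [Fintype β] (V : Matrix β α ℂ) (X : Matrix α α ℂ)
      (Y : Matrix β β ℂ), (V * X * Vᴴ * Y).trace = (X * (Vᴴ * Y * V)).trace := by
    intro α β _ _ V X Y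
    rw [Matrix.mul_assoc, Matrix.mul_assoc, Matrix.trace_mul_comm]
    simp only [Matrix.mul_assoc]
  rw [trace_reduceTo_mul, hcyc, hcyc, conjTranspose_funMat_mul_mul, conjTranspose_funMat_mul_mul,
    onFactor_submatrix hw, trace_reduceTo_mul]

theorem isDiag_reduceTo (i : I) {σ : Matrix (∀ j, τ j) (∀ j, τ j) ℂ} (hσ : σ.IsDiag) :
    (reduceTo i σ).IsDiag := by
  intro a b hab
  simp only [reduceTo, Matrix.of_apply]
  refine Finset.sum_eq_zero fun z _ => ?_
  split_ifs with h
  · refine hσ fun h' => hab ?_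
    have := congrFun h' i
    rw [← h, this, Function.update_self]
  · rfl

end Composite

/-! ### The objective as a function of the reduced states -/

namespace Setup

variable {M N : ℕ} (S : Setup M N)

/-- The Hamiltonian of the particles of collection `i`. -/
def hamiltonian (i : Fin M) :
    Matrix (∀ k : Fin N, Fin (S.dim i k)) (∀ k : Fin N, Fin (S.dim i k)) ℂ :=
  ∑ k, onFactor (τ := fun k => Fin (S.dim i k)) k (S.h i k)

/-- The operator `∑_{k ≠ l} D₊^(i,k) D₋^(i,l)` on the particles of collection `i`. -/
def exchange (i : Fin M) :
    Matrix (∀ k : Fin N, Fin (S.dim i k)) (∀ k : Fin N, Fin (S.dim i k)) ℂ :=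
  ∑ k, ∑ l, if k ≠ l then
    onFactor (τ := fun k => Fin (S.dim i k)) k (Matrix.single (S.e i k) (S.g i k) 1) *
      onFactor (τ := fun k => Fin (S.dim i k)) l (Matrix.single (S.g i l) (S.e i l) 1) else 0

/-- The contribution of collection `i` to the objective, as a function of its state. -/
def cellValue (a : Fin M → ℕ) (i : Fin M) (ρ : Matrix (S.Cell a i) (S.Cell a i) ℂ) : ℝ :=
  1 / 4 * qfi ρ (S.hamiltonian i ⊗ₖ (1 : Matrix (Fin (a i)) (Fin (a i)) ℂ)) +
    (ρ * (S.exchange i ⊗ₖ (1 : Matrix (Fin (a i)) (Fin (a i)) ℂ))).trace.re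

theorem sum_kronecker_one {ν α β : Type} [Fintype α] [Fintype β] [DecidableEq β] (s : Finset ν)
    (A : ν → Matrix α α ℂ) :
    (∑ n ∈ s, A n) ⊗ₖ (1 : Matrix β β ℂ) = ∑ n ∈ s, A n ⊗ₖ (1 : Matrix β β ℂ) := by
  ext x y
  simp [Matrix.kroneckerMap_apply, Matrix.sum_apply, Finset.sum_mul]

theorem signal_eq (a : Fin M → ℕ) (i : Fin M) :
    S.signal a i = S.hamiltonian i ⊗ₖ (1 : Matrix (Fin (a i)) (Fin (a i)) ℂ) := by
  rw [signal, hamiltonian, sum_kronecker_one]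
  rfl

theorem superradiance_eq (a : Fin M → ℕ) (i : Fin M) (σ : Matrix (S.Out a) (S.Out a) ℂ) :
    S.superradiance a i σ = (reduceTo (τ := S.Cell a) i σ *
      (S.exchange i ⊗ₖ (1 : Matrix (Fin (a i)) (Fin (a i)) ℂ))).trace.re := by
  rw [superradiance, exchange, sum_kronecker_one, Matrix.mul_sum, Matrix.trace_sum]
  congr 1
  refine Finset.sum_congr rfl fun k _ => ?_
  rw [sum_kronecker_one, Matrix.mul_sum, Matrix.trace_sum]
  refine Finset.sum_congr rfl fun l _ => ?_
  split_ifs with h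
  · rw [trace_reduceTo_mul, raising, lowering, Matrix.mul_assoc, onFactor_mul, onParticle,
      onParticle, ← Matrix.mul_kronecker_mul, Matrix.mul_one]
  · rw [Matrix.zero_kronecker, Matrix.mul_zero, Matrix.trace_zero]

theorem objective_eq (a : Fin M → ℕ) (σ : Matrix (S.Out a) (S.Out a) ℂ) :
    S.objective a σ = ∑ i, S.cellValue a i (reduceTo (τ := S.Cell a) i σ) := by
  simp only [objective, superradiance_eq, signal_eq, cellValue]

theorem hamiltonian_eq_diagonal (i : Fin M) :
    S.hamiltonian i = Matrix.diagonal fun p => ∑ k, S.h i k (p k) (p k) := by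
  ext p q
  rw [hamiltonian, Matrix.sum_apply]
  by_cases hpq : p = q
  · subst hpq
    simp [onFactor]
  · rw [Matrix.diagonal_apply_ne _ hpq]
    refine Finset.sum_eq_zero fun k _ => ?_
    simp only [onFactor, Matrix.of_apply]
    split_ifs with h
    · refine S.h_isDiag i k fun h' => hpq ?_
      funext j
      by_cases hj : j = k
      · subst hj; exact h'
      · exact h j hj
    · rfl

theorem hamiltonian_kronecker_one_eq_diagonal (i : Fin M) (b : ℕ) :
    S.hamiltonian i ⊗ₖ (1 : Matrix (Fin b) (Fin b) ℂ) =
      Matrix.diagonal fun x => ∑ k, S.h i k (x.1 k) (x.1 k) := by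
  rw [hamiltonian_eq_diagonal, ← Matrix.diagonal_one, Matrix.diagonal_kronecker_diagonal]
  simp

theorem isHermitian_hamiltonian_kronecker_one (i : Fin M) (b : ℕ) :
    (S.hamiltonian i ⊗ₖ (1 : Matrix (Fin b) (Fin b) ℂ)).IsHermitian := by
  rw [hamiltonian_kronecker_one_eq_diagonal, Matrix.isHermitian_diagonal_iff]
  intro x
  rw [IsSelfAdjoint, star_sum]
  exact Finset.sum_congr rfl fun k _ => (S.h_isHermitian i k).apply _ _

/-- Each term of the exchange operator flips two different particles, so its nonzero entries change
at least two coordinates. -/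
theorem exchange_apply_eq_zero (i : Fin M) {p q : ∀ k : Fin N, Fin (S.dim i k)}
    (h : ∀ k l, k ≠ l → p k = q k ∨ p l = q l) : S.exchange i p q = 0 := by
  rw [exchange, Matrix.sum_apply]
  refine Finset.sum_eq_zero fun k _ => ?_
  rw [Matrix.sum_apply]
  refine Finset.sum_eq_zero fun l _ => ?_
  split_ifs with hkl
  swap
  · rfl
  rw [Matrix.mul_apply]
  refine Finset.sum_eq_zero fun z _ => ?_
  by_contra hne
  obtain ⟨h1, h2⟩ := mul_ne_zero_iff.1 hne
  obtain ⟨a1, a2, a3⟩ := of_onFactor_single_apply_ne_zero h1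
  obtain ⟨b1, b2, b3⟩ := of_onFactor_single_apply_ne_zero h2
  rcases h k l hkl with hk | hl
  · exact S.g_ne_e i k (by rw [← a1, ← a2, hk, b3 k hkl])
  · exact S.g_ne_e i l (by rw [← b1, ← b2, ← hl, a3 l hkl.symm])

theorem trace_mul_exchange_eq_zero (a : Fin M → ℕ) (i : Fin M)
    {ρ : Matrix (S.Cell a i) (S.Cell a i) ℂ}
    (h : ∀ x y, ρ x y ≠ 0 → ∀ k l, k ≠ l → x.1 k = y.1 k ∨ x.1 l = y.1 l) :
    (ρ * (S.exchange i ⊗ₖ (1 : Matrix (Fin (a i)) (Fin (a i)) ℂ))).trace = 0 := by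
  refine Finset.sum_eq_zero fun x _ => ?_
  rw [Matrix.diag_apply, Matrix.mul_apply]
  refine Finset.sum_eq_zero fun y _ => ?_
  by_cases hxy : ρ x y = 0
  · rw [hxy, zero_mul]
  · rw [Matrix.kroneckerMap_apply, S.exchange_apply_eq_zero i (p := y.1) (q := x.1), zero_mul,
      mul_zero]
    intro k l hkl
    simpa only [eq_comm] using h x y hxy k l hkl

/-! #### Properties of the objective -/

theorem cellValue_sum_le {ν : Type*} (s : Finset ν) (a : Fin M → ℕ) (i : Fin M)
    {ρ : ν → Matrix (S.Cell a i) (S.Cell a i) ℂ} (hρ : ∀ n ∈ s, (ρ n).PosSemidef) :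
    S.cellValue a i (∑ n ∈ s, ρ n) ≤ ∑ n ∈ s, S.cellValue a i (ρ n) := by
  simp only [cellValue, Finset.sum_add_distrib, Matrix.sum_mul, Matrix.trace_sum, Complex.re_sum,
    ← Finset.mul_sum]
  have := qfi_sum_le s hρ (S.hamiltonian i ⊗ₖ (1 : Matrix (Fin (a i)) (Fin (a i)) ℂ))
  linarith

theorem objective_sum_le {ν : Type*} (s : Finset ν) (a : Fin M → ℕ)
    {σ : ν → Matrix (S.Out a) (S.Out a) ℂ} (hσ : ∀ n ∈ s, (σ n).PosSemidef) :
    S.objective a (∑ n ∈ s, σ n) ≤ ∑ n ∈ s, S.objective a (σ n) := by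
  simp only [objective_eq]
  rw [Finset.sum_comm]
  refine Finset.sum_le_sum fun i _ => ?_
  rw [reduceTo_sum]
  exact S.cellValue_sum_le s a i fun n hn => posSemidef_reduceTo i (hσ n hn)

theorem objective_smul (a : Fin M → ℕ) {σ : Matrix (S.Out a) (S.Out a) ℂ} (hσ : σ.PosSemidef)
    {c : ℝ} (hc : 0 ≤ c) : S.objective a (c • σ) = c * S.objective a σ := by
  simp only [objective_eq, Finset.mul_sum]
  refine Finset.sum_congr rfl fun i _ => ?_
  rw [reduceTo_smul, cellValue, cellValue, qfi_smul (posSemidef_reduceTo i hσ) _ hc,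
    Matrix.smul_mul, Matrix.trace_smul, Complex.smul_re, smul_eq_mul]
  ring

theorem exists_continuous_eq_objective (a : Fin M → ℕ) :
    ∃ G : Matrix (S.Out a) (S.Out a) ℂ → ℝ, Continuous G ∧
      ∀ σ, σ.PosSemidef → S.objective a σ = G σ := by
  choose G hG hGq using fun i : Fin M =>
    exists_continuous_eq_qfi (S.hamiltonian i ⊗ₖ (1 : Matrix (Fin (a i)) (Fin (a i)) ℂ))
  refine ⟨fun σ => ∑ i, (1 / 4 * G i (reduceTo (τ := S.Cell a) i σ) +
    (reduceTo (τ := S.Cell a) i σ *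
      (S.exchange i ⊗ₖ (1 : Matrix (Fin (a i)) (Fin (a i)) ℂ))).trace.re), ?_, fun σ hσ => ?_⟩
  · refine continuous_finsetSum _ fun i _ => ?_
    have h1 := continuous_reduceTo (τ := S.Cell a) i
    have h2 := (hG i).comp h1
    simp only [Function.comp_def] at h2
    fun_prop
  · rw [objective_eq]
    refine Finset.sum_congr rfl fun i _ => ?_
    rw [cellValue, hGq i _ (posSemidef_reduceTo i hσ)]

theorem cellValue_eq_zero_of_isDiag (a : Fin M → ℕ) (i : Fin M)
    {ρ : Matrix (S.Cell a i) (S.Cell a i) ℂ} (hρ : ρ.PosSemidef) (hd : ρ.IsDiag) :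
    S.cellValue a i ρ = 0 := by
  rw [cellValue, qfi_eq_zero_of_commute hρ, S.trace_mul_exchange_eq_zero a i]
  · simp
  · intro x y hxy k l _
    have : x = y := by
      by_contra hne
      exact hxy (hd hne)
    exact Or.inl (by rw [this])
  · rw [hamiltonian_kronecker_one_eq_diagonal, ← hd.diagonal_diag,
      Matrix.diagonal_mul_diagonal, Matrix.diagonal_mul_diagonal]
    congr 1
    funext x
    exact mul_comm _ _

theorem objective_eq_zero_of_isDiag (a : Fin M → ℕ) {σ : Matrix (S.Out a) (S.Out a) ℂ}
    (hσ : σ.PosSemidef) (hd : σ.IsDiag) : S.objective a σ = 0 := by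
  rw [objective_eq]
  exact Finset.sum_eq_zero fun i _ =>
    S.cellValue_eq_zero_of_isDiag a i (posSemidef_reduceTo i hσ) (isDiag_reduceTo i hd)

/-- The embedding of collections induced by a map between the ancillary basis labels. -/
def cellEmbed {a b : Fin M → ℕ} (i : Fin M) (e : Fin (a i) → Fin (b i)) (x : S.Cell a i) :
    S.Cell b i :=
  Prod.map id e x

theorem kronecker_one_mul_cellEmbed {a b : Fin M → ℕ} (i : Fin M) (e : Fin (a i) → Fin (b i))
    (A : Matrix (∀ k : Fin N, Fin (S.dim i k)) (∀ k : Fin N, Fin (S.dim i k)) ℂ) :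
    (A ⊗ₖ (1 : Matrix (Fin (b i)) (Fin (b i)) ℂ) : Matrix (S.Cell b i) (S.Cell b i) ℂ) *
      funMat (S.cellEmbed i e) =
      funMat (S.cellEmbed i e) *
        (A ⊗ₖ (1 : Matrix (Fin (a i)) (Fin (a i)) ℂ) : Matrix (S.Cell a i) (S.Cell a i) ℂ) :=
  kronecker_one_mul_funMat e A

/-- The embedding of output systems induced by maps between the ancillary basis labels. -/
def embed {a b : Fin M → ℕ} (e : ∀ i, Fin (a i) → Fin (b i)) (x : S.Out a) : S.Out b :=
  fun i => S.cellEmbed i (e i) (x i)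

/-- The ancilla ranges are disjoint in every collection, so each local reduced state is an
orthogonal sum of blocks. The operators of the task act trivially on the ancillas and hence respect
the blocks. -/
theorem objective_directSum {ν : Type} [Fintype ν] [DecidableEq ν] {a : ν → Fin M → ℕ}
    {b : Fin M → ℕ} {e : ∀ n i, Fin (a n i) → Fin (b i)}
    (he : ∀ n i, Function.Injective (e n i)) (hee : ∀ n m i x y, n ≠ m → e n i x ≠ e m i y)
    {σ : ∀ n, Matrix (S.Out (a n)) (S.Out (a n)) ℂ} (hσ : ∀ n, (σ n).PosSemidef) :
    S.objective b (∑ n, funMat (S.embed (e n)) * σ n * (funMat (S.embed (e n)))ᴴ) =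
      ∑ n, S.objective (a n) (σ n) := by
  simp only [objective_eq]
  rw [Finset.sum_comm]
  refine Finset.sum_congr rfl fun i _ => ?_
  have hinj : ∀ n j, Function.Injective
      (S.cellEmbed (a := a n) (b := b) j (e n j)) := fun n j =>
    Function.Injective.prodMap Function.injective_id (he n j)
  have hred : ∀ n, reduceTo (τ := S.Cell b) i
      (funMat (S.embed (e n)) * σ n * (funMat (S.embed (e n)))ᴴ) =
      funMat (S.cellEmbed (a := a n) i (e n i)) * reduceTo (τ := S.Cell (a n)) i (σ n) *
        (funMat (S.cellEmbed (a := a n) i (e n i)))ᴴ := fun n =>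
    reduceTo_funMat_conj (τ := S.Cell b) (τ' := S.Cell (a n)) (hinj n) i (σ n)
  rw [reduceTo_sum]
  simp only [hred, cellValue, Finset.sum_add_distrib, ← Finset.mul_sum]
  rw [qfi_directSum (γ := fun n => S.Cell (a n) i)
    (fun n => conjTranspose_funMat_mul_self (hinj n i)) (fun n m hnm => ?_)
    (S.isHermitian_hamiltonian_kronecker_one i (b i))
    (fun n => S.isHermitian_hamiltonian_kronecker_one i (a n i))
    (fun n => S.kronecker_one_mul_cellEmbed i (e n i) (S.hamiltonian i))
    (fun n => posSemidef_reduceTo i (hσ n))]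
  · rw [Matrix.sum_mul, Matrix.trace_sum, Complex.re_sum]
    congr 1
    refine Finset.sum_congr rfl fun n _ => ?_
    congr 1
    rw [Matrix.mul_assoc, Matrix.mul_assoc, Matrix.trace_mul_comm, Matrix.mul_assoc,
      Matrix.mul_assoc, kronecker_one_mul_cellEmbed, ← Matrix.mul_assoc (funMat _)ᴴ,
      conjTranspose_funMat_mul_self (hinj n i), Matrix.one_mul]
  · refine conjTranspose_funMat_mul_of_disjoint fun x y h => ?_
    exact hee n m i x.2 y.2 hnm (congrArg Prod.snd h)

end Setup

/-! ### Incoherent Kraus operators -/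

section Kraus

variable {ι κ μ : Type} [Fintype ι] [Fintype κ] [Fintype μ] [DecidableEq ι] [DecidableEq κ]
  [DecidableEq μ]

/-- Each column has at most one nonzero entry. -/
def IsSparse (K : Matrix κ ι ℂ) : Prop := ∀ j x y, K x j ≠ 0 → K y j ≠ 0 → x = y

/-- Applied to the basis state j, the operator gives off-diagonal entries equal to products of two
entries of column j. -/
theorem IsIncoherentKraus.isSparse {r : ℕ} {K : Fin r → Matrix κ ι ℂ} (hK : IsIncoherentKraus K)
    (n : Fin r) : IsSparse (K n) := by
  intro j x y hx hy
  by_contra hxy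
  have hδ : IsIncoherent (Matrix.single j j (1 : ℂ)) := by
    have h : Matrix.single j j (1 : ℂ) = Matrix.diagonal (Pi.single j 1) := by
      rw [Matrix.diagonal_single]
    refine ⟨⟨?_, by simp⟩, ?_⟩
    · rw [h]
      exact Matrix.PosSemidef.diagonal (Pi.single_nonneg.2 zero_le_one)
    · rw [h]
      exact Matrix.isDiag_diagonal _
  have h := hK.2 n _ hδ hxy
  have h' : (K n * Matrix.single j j (1 : ℂ) * (K n)ᴴ) x y = K n x j * star (K n y j) := by
    rw [Matrix.mul_apply, Finset.sum_eq_single j]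
    · simp
    · intro i _ hij
      rw [Matrix.mul_single_apply_of_ne _ _ _ _ _ hij, zero_mul]
    · simp
  have h'' : (K n * Matrix.single j j (1 : ℂ) * (K n)ᴴ) x y = 0 := h
  rw [h'] at h''
  exact mul_ne_zero hx (star_ne_zero.2 hy) h''

theorem IsSparse.isDiag_conj {K : Matrix κ ι ℂ} (hK : IsSparse K) {δ : Matrix ι ι ℂ}
    (hδ : δ.IsDiag) : (K * δ * Kᴴ).IsDiag := by
  intro x y hxy
  rw [← hδ.diagonal_diag, Matrix.mul_apply]
  refine Finset.sum_eq_zero fun j _ => ?_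
  rw [Matrix.mul_diagonal, Matrix.conjTranspose_apply]
  by_cases hx : K x j = 0
  · rw [hx, zero_mul, zero_mul]
  · by_cases hy : K y j = 0
    · rw [hy, star_zero, mul_zero]
    · exact absurd (hK j x y hx hy) hxy

theorem isICPTP_of_isSparse {ν : Type} [Fintype ν] {K : ν → Matrix κ ι ℂ}
    (h1 : ∑ n, (K n)ᴴ * K n = 1) (h2 : ∀ n, IsSparse (K n)) :
    IsICPTP fun ρ : Matrix ι ι ℂ => ∑ n, K n * ρ * (K n)ᴴ := by
  let e := (Fintype.equivFin ν).symm
  refine ⟨Fintype.card ν, fun n => K (e n), ⟨?_, fun n δ hδ => (h2 _).isDiag_conj hδ.2⟩,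
    fun ρ => ?_⟩
  · rw [← h1]
    exact Equiv.sum_comp e fun n => (K n)ᴴ * K n
  · exact (Equiv.sum_comp e fun n => K n * ρ * (K n)ᴴ).symm

theorem IsSparse.mul {L : Matrix μ κ ℂ} {K : Matrix κ ι ℂ} (hL : IsSparse L) (hK : IsSparse K) :
    IsSparse (L * K) := by
  intro j x y hx hy
  rw [Matrix.mul_apply] at hx hy
  obtain ⟨u, -, hu⟩ := Finset.exists_ne_zero_of_sum_ne_zero hx
  obtain ⟨v, -, hv⟩ := Finset.exists_ne_zero_of_sum_ne_zero hy
  have huv : u = v := hK j u v (right_ne_zero_of_mul hu) (right_ne_zero_of_mul hv)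
  subst huv
  exact hL u x y (left_ne_zero_of_mul hu) (left_ne_zero_of_mul hv)

theorem isSparse_funMat (f : ι → κ) : IsSparse (funMat f) := by
  intro j x y hx hy
  simp only [funMat, Matrix.of_apply, ne_eq, ite_eq_right_iff, one_ne_zero, imp_false,
    not_not] at hx hy
  rw [hx, hy]

theorem isSparse_diagonal (c : ι → ℂ) : IsSparse (Matrix.diagonal c) := by
  intro j x y hx hy
  have h1 : x = j := by
    by_contra h
    exact hx (Matrix.diagonal_apply_ne _ h)
  have h2 : y = j := by
    by_contra h
    exact hy (Matrix.diagonal_apply_ne _ h)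
  rw [h1, h2]

/-- The operator sending the basis vector `j` to `c j` times the basis vector `f j`. -/
def colMat (f : ι → κ) (c : ι → ℂ) : Matrix κ ι ℂ := funMat f * Matrix.diagonal c

theorem isSparse_colMat (f : ι → κ) (c : ι → ℂ) : IsSparse (colMat f c) :=
  (isSparse_funMat f).mul (isSparse_diagonal c)

theorem colMat_smul (f : ι → κ) (s : ℂ) (c : ι → ℂ) : colMat f (s • c) = s • colMat f c := by
  rw [colMat, colMat, ← Matrix.mul_smul, Matrix.diagonal_smul]

theorem colMat_apply (f : ι → κ) (c : ι → ℂ) (x : κ) (j : ι) :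
    colMat f c x j = if x = f j then c j else 0 := by
  simp [colMat, Matrix.mul_diagonal, funMat]

theorem IsSparse.exists_eq_colMat [Nonempty κ] {K : Matrix κ ι ℂ} (hK : IsSparse K) :
    ∃ (f : ι → κ) (c : ι → ℂ), K = colMat f c := by
  have h : ∀ j, ∃ x, ∀ y, y ≠ x → K y j = 0 := by
    intro j
    by_cases hj : ∃ x, K x j ≠ 0
    · obtain ⟨x, hx⟩ := hj
      refine ⟨x, fun y hyx => ?_⟩
      by_contra hy
      exact hyx (hK j y x hy hx)
    · push Not at hj
      exact ⟨Classical.arbitrary κ, fun y _ => hj y⟩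
  choose f hf using h
  refine ⟨f, fun j => K (f j) j, ?_⟩
  ext x j
  rw [colMat_apply]
  split_ifs with hx
  · rw [hx]
  · exact hf j x hx

theorem funMat_mul_colMat (g : κ → μ) (f : ι → κ) (c : ι → ℂ) :
    funMat g * colMat f c = colMat (g ∘ f) c := by
  rw [colMat, colMat, ← Matrix.mul_assoc]
  congr 1
  ext x j
  rw [mul_funMat_apply]
  rfl

theorem trace_conjTranspose_mul_colMat (f : ι → κ) (c : ι → ℂ) :
    ((colMat f c)ᴴ * colMat f c).trace = ((∑ j, ‖c j‖ ^ 2 : ℝ) : ℂ) := by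
  simp only [Matrix.trace, Matrix.diag, Matrix.mul_apply, Matrix.conjTranspose_apply,
    colMat_apply, Complex.ofReal_sum]
  refine Finset.sum_congr rfl fun j _ => ?_
  rw [Finset.sum_eq_single (f j)]
  · rw [if_pos rfl, Complex.star_def, Complex.conj_mul']
    norm_cast
  · intro x _ hx
    rw [if_neg hx, mul_zero]
  · simp

/-! ### Projectors -/

theorem posSemidef_proj (ψ : ι → ℂ) : (proj ψ).PosSemidef :=
  Matrix.posSemidef_vecMulVec_self_star ψ

theorem conj_proj (K : Matrix κ ι ℂ) (ψ : ι → ℂ) : K * proj ψ * Kᴴ = proj (K *ᵥ ψ) := by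
  rw [proj, proj, Matrix.mul_vecMulVec, Matrix.vecMulVec_mul, Matrix.star_mulVec]

theorem proj_smul (c : ℂ) (ψ : ι → ℂ) : proj (c • ψ) = (‖c‖ ^ 2 : ℝ) • proj ψ := by
  ext x y
  simp only [proj, Matrix.vecMulVec_apply, Pi.smul_apply, Pi.star_apply, smul_eq_mul, star_mul',
    Matrix.smul_apply, Complex.real_smul]
  have : (c * star c) = ((‖c‖ ^ 2 : ℝ) : ℂ) := by
    rw [Complex.star_def, Complex.mul_conj']
    norm_cast
  rw [← this]
  ring

theorem trace_proj (ψ : ι → ℂ) : (proj ψ).trace = ((∑ i, ‖ψ i‖ ^ 2 : ℝ) : ℂ) := by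
  simp only [Matrix.trace, Matrix.diag, proj, Matrix.vecMulVec_apply, Pi.star_apply,
    Complex.ofReal_sum]
  refine Finset.sum_congr rfl fun j _ => ?_
  rw [Complex.star_def, Complex.mul_conj']
  norm_cast

theorem continuous_proj : Continuous (proj : (ι → ℂ) → Matrix ι ι ℂ) := by
  unfold proj
  refine continuous_matrix fun a b => ?_
  simp only [Matrix.vecMulVec_apply, Pi.star_apply]
  fun_prop

theorem IsICPTP.posSemidef {Φ : Matrix ι ι ℂ → Matrix κ κ ℂ} (hΦ : IsICPTP Φ) {ρ : Matrix ι ι ℂ}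
    (hρ : ρ.PosSemidef) : (Φ ρ).PosSemidef := by
  obtain ⟨r, K, -, h⟩ := hΦ
  rw [h]
  exact Matrix.posSemidef_sum _ fun n _ => hρ.mul_mul_conjTranspose_same (K n)

theorem IsICPTP.map_smul {Φ : Matrix ι ι ℂ → Matrix κ κ ℂ} (hΦ : IsICPTP Φ) (c : ℝ)
    (ρ : Matrix ι ι ℂ) : Φ (c • ρ) = c • Φ ρ := by
  obtain ⟨r, K, -, h⟩ := hΦ
  simp only [h, Matrix.mul_smul, Matrix.smul_mul, Finset.smul_sum]

theorem IsICPTP.continuous {Φ : Matrix ι ι ℂ → Matrix κ κ ℂ} (hΦ : IsICPTP Φ) :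
    Continuous Φ := by
  obtain ⟨r, K, -, h⟩ := hΦ
  have : Φ = fun ρ => ∑ n, K n * ρ * (K n)ᴴ := funext h
  rw [this]
  fun_prop

theorem IsICPTP.isDiag {Φ : Matrix ι ι ℂ → Matrix κ κ ℂ} (hΦ : IsICPTP Φ) {ρ : Matrix ι ι ℂ}
    (hρ : ρ.IsDiag) : (Φ ρ).IsDiag := by
  obtain ⟨r, K, hK, h⟩ := hΦ
  rw [h]
  intro x y hxy
  rw [Matrix.sum_apply]
  exact Finset.sum_eq_zero fun n _ => (hK.isSparse n).isDiag_conj hρ hxy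

end Kraus

namespace Setup

variable {M N : ℕ} (S : Setup M N) {ι : Type} [Fintype ι] [DecidableEq ι]

/-! ### Operations with classical flags -/

/-- Recording the branch `n` of an incoherent operation in the ancillary particles of every
collection makes the objective the sum of the objectives of the branches. -/
theorem sum_objective_mem_pureValues {ν : Type} [Fintype ν] [DecidableEq ν] {μ : ν → Type}
    [∀ n, Fintype (μ n)] (a : ν → Fin M → ℕ) (L : ∀ n, μ n → Matrix (S.Out (a n)) ι ℂ)
    (hL : ∀ n m, IsSparse (L n m)) (h1 : ∑ n, ∑ m, (L n m)ᴴ * L n m = 1) (ψ : ι → ℂ) :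
    ∑ n, S.objective (a n) (∑ m, proj (L n m *ᵥ ψ)) ∈ S.pureValues ψ := by
  -- Each new ancilla is the direct sum of those of the branches, so its label also reveals n.
  let b : Fin M → ℕ := fun i => Fintype.card (Σ n, Fin (a n i))
  let e : ∀ n i, Fin (a n i) → Fin (b i) := fun n i x => Fintype.equivFin _ ⟨n, x⟩
  have he : ∀ n i, Function.Injective (e n i) := by
    intro n i x y h
    have := (Fintype.equivFin _).injective h
    simpa using this
  have hee : ∀ n m i x y, n ≠ m → e n i x ≠ e m i y := by
    intro n m i x y hnm h
    have := (Fintype.equivFin _).injective h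
    exact hnm (congrArg Sigma.fst this)
  have hembed : ∀ n, Function.Injective (S.embed (e n)) := by
    intro n x y h
    funext i
    exact Function.Injective.prodMap Function.injective_id (he n i) (congrFun h i)
  let K : (Σ n, μ n) → Matrix (S.Out b) ι ℂ := fun q => funMat (S.embed (e q.1)) * L q.1 q.2
  refine ⟨b, fun ρ : Matrix ι ι ℂ => ∑ q, K q * ρ * (K q)ᴴ, isICPTP_of_isSparse ?_ fun q =>
    (isSparse_funMat _).mul (hL _ _), ?_⟩
  · rw [Fintype.sum_sigma, ← h1]
    refine Finset.sum_congr rfl fun n _ => Finset.sum_congr rfl fun m _ => ?_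
    simp only [K]
    rw [Matrix.conjTranspose_mul, Matrix.mul_assoc, ← Matrix.mul_assoc (funMat _)ᴴ,
      conjTranspose_funMat_mul_self (hembed n), Matrix.one_mul]
  · rw [← S.objective_directSum he hee fun n =>
      Matrix.posSemidef_sum _ fun m _ => posSemidef_proj (L n m *ᵥ ψ)]
    change _ = S.objective b (∑ q, K q * proj ψ * (K q)ᴴ)
    congr 1
    rw [Fintype.sum_sigma]
    refine Finset.sum_congr rfl fun n _ => ?_
    rw [Matrix.mul_sum, Matrix.sum_mul]
    refine Finset.sum_congr rfl fun m _ => ?_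
    rw [conj_proj, conj_proj, Matrix.mulVec_mulVec]

/-! ### Finitely many types of Kraus operators -/

/-- Only the ancilla labels that f hits matter, at most card ι in each collection. This bound does
not depend on a, which leaves finitely many patterns. -/
theorem exists_embed_factorization (a : Fin M → ℕ) (f : ι → S.Out a) :
    ∃ (d : Fin M → Fin (Fintype.card ι + 1)) (e : ∀ i, Fin (d i) → Fin (a i))
      (g : ι → S.Out fun i => d i), (∀ i, Function.Injective (e i)) ∧ f = S.embed e ∘ g := by
  let s : ∀ i, Finset (Fin (a i)) := fun i => Finset.univ.image fun j => (f j i).2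
  have hs : ∀ i, (s i).card < Fintype.card ι + 1 := fun i =>
    Nat.lt_succ_of_le Finset.card_image_le
  refine ⟨fun i => ⟨(s i).card, hs i⟩, fun i x => ((s i).equivFin.symm x).1,
    fun j i => ((f j i).1, (s i).equivFin
      ⟨(f j i).2, Finset.mem_image_of_mem _ (Finset.mem_univ j)⟩), fun i x y h => ?_, ?_⟩
  · exact (s i).equivFin.symm.injective (Subtype.ext h)
  · funext j i
    simp [embed, cellEmbed]

/-- The pattern of a Kraus operator from `ι`: the numbers of ancillary basis states that it uses and
the image of each basis vector. -/
abbrev Pattern (S : Setup M N) (ι : Type) [Fintype ι] : Type :=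
  Σ d : Fin M → Fin (Fintype.card ι + 1), ι → S.Out fun i => (d i : ℕ)

/-- The objective after a single Kraus operator. -/
def branchValue (t : S.Pattern ι) (c ψ : ι → ℂ) : ℝ :=
  S.objective (fun i => (t.1 i : ℕ)) (proj (colMat t.2 c *ᵥ ψ))

theorem branchValue_smul_left (t : S.Pattern ι) (s : ℂ) (c ψ : ι → ℂ) :
    S.branchValue t (s • c) ψ = ‖s‖ ^ 2 * S.branchValue t c ψ := by
  rw [branchValue, colMat_smul, Matrix.smul_mulVec, proj_smul,
    S.objective_smul _ (posSemidef_proj _) (by positivity), branchValue]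

theorem continuous_branchValue (t : S.Pattern ι) :
    Continuous fun q : (ι → ℂ) × (ι → ℂ) => S.branchValue t q.1 q.2 := by
  obtain ⟨G, hG, h⟩ := S.exists_continuous_eq_objective fun i => (t.1 i : ℕ)
  have : (fun q : (ι → ℂ) × (ι → ℂ) => S.branchValue t q.1 q.2) =
      fun q => G (proj (colMat t.2 q.1 *ᵥ q.2)) := by
    funext q
    exact h _ (posSemidef_proj _)
  rw [this]
  refine hG.comp (continuous_proj.comp ?_)
  unfold colMat
  fun_prop

theorem exists_branchValue_of_isSparse (a : Fin M → ℕ) [Nonempty (S.Out a)]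
    {K : Matrix (S.Out a) ι ℂ} (hK : IsSparse K) :
    ∃ (t : S.Pattern ι) (c : ι → ℂ), Kᴴ * K = (colMat t.2 c)ᴴ * colMat t.2 c ∧
      ∀ ψ, S.objective a (proj (K *ᵥ ψ)) = S.branchValue t c ψ := by
  obtain ⟨f, c, rfl⟩ := hK.exists_eq_colMat
  obtain ⟨d, e, g, he, rfl⟩ := S.exists_embed_factorization a f
  have hembed : Function.Injective (S.embed e) := by
    intro x y h
    funext i
    exact Function.Injective.prodMap Function.injective_id (he i) (congrFun h i)
  refine ⟨⟨d, g⟩, c, ?_, fun ψ => ?_⟩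
  · rw [← funMat_mul_colMat, Matrix.conjTranspose_mul, Matrix.mul_assoc,
      ← Matrix.mul_assoc (funMat _)ᴴ, conjTranspose_funMat_mul_self hembed, Matrix.one_mul]
  -- With a single block, the direct sum law says that enlarging the ancillas does not change the
  -- objective.
  · have := S.objective_directSum (ν := Unit) (a := fun _ i => (d i : ℕ)) (b := a)
      (e := fun _ => e) (fun _ => he) (fun n m _ _ _ h => absurd (Subsingleton.elim n m) h)
      (fun _ => posSemidef_proj (colMat g c *ᵥ ψ))
    rw [Fintype.sum_unique, Fintype.sum_unique, conj_proj, Matrix.mulVec_mulVec,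
      funMat_mul_colMat] at this
    exact this

end Setup

/-! ### The joint quantity of pure states -/

theorem isCompact_setOf_isPure (ι : Type) [Fintype ι] : IsCompact {c : ι → ℂ | IsPure c} := by
  have hbox : IsCompact (Set.univ.pi fun _ : ι => Metric.closedBall (0 : ℂ) 1) :=
    isCompact_univ_pi fun _ => isCompact_closedBall _ _
  have hcont : Continuous fun c : ι → ℂ => ∑ j, ‖c j‖ ^ 2 := by fun_prop
  refine hbox.of_isClosed_subset (isClosed_eq hcont continuous_const) fun c hc j _ => ?_
  rw [mem_closedBall_zero_iff]
  have h1 : ‖c j‖ ^ 2 ≤ ∑ j, ‖c j‖ ^ 2 :=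
    Finset.single_le_sum (f := fun j => ‖c j‖ ^ 2) (fun i _ => by positivity) (Finset.mem_univ j)
  have h2 : ‖c j‖ ^ 2 ≤ 1 := h1.trans (le_of_eq hc)
  nlinarith [norm_nonneg (c j)]

theorem isPure_single {ι : Type} [Fintype ι] [DecidableEq ι] (j : ι) :
    IsPure (Pi.single j (1 : ℂ)) := by
  rw [IsPure, Finset.sum_eq_single j]
  · simp
  · intro i _ hij
    simp [Pi.single_eq_of_ne hij]
  · simp

theorem exists_isPure_smul {ι : Type} [Fintype ι] [DecidableEq ι] [Nonempty ι] (c : ι → ℂ) :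
    ∃ (s : ℂ) (u : ι → ℂ), IsPure u ∧ c = s • u ∧ ‖s‖ ^ 2 = ∑ j, ‖c j‖ ^ 2 := by
  have hnn : 0 ≤ ∑ j, ‖c j‖ ^ 2 := by positivity
  rcases hnn.eq_or_lt with h | h
  · refine ⟨0, Pi.single (Classical.arbitrary ι) 1, isPure_single _, ?_, by simpa using h⟩
    have := (Finset.sum_eq_zero_iff_of_nonneg fun j _ => by positivity).1 h.symm
    funext j
    simpa using this j (Finset.mem_univ j)
  · set t : ℝ := Real.sqrt (∑ j, ‖c j‖ ^ 2) with ht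
    have htp : 0 < t := Real.sqrt_pos.2 h
    have hts : t ^ 2 = ∑ j, ‖c j‖ ^ 2 := Real.sq_sqrt hnn
    refine ⟨(t : ℂ), ((t : ℂ)⁻¹) • c, ?_, ?_, ?_⟩
    · simp only [IsPure, Pi.smul_apply, smul_eq_mul, norm_mul, norm_inv, Complex.norm_real,
        mul_pow, Real.norm_eq_abs, inv_pow, sq_abs]
      rw [← Finset.mul_sum, ← hts]
      exact inv_mul_cancel₀ (by positivity)
    · rw [smul_smul, mul_inv_cancel₀ (by exact_mod_cast htp.ne'), one_smul]
    · rw [Complex.norm_real, Real.norm_eq_abs, sq_abs, hts]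

theorem conjTranspose_colMat_mul_self_apply {ι κ : Type} [Fintype ι] [Fintype κ] [DecidableEq ι]
    [DecidableEq κ] (f : ι → κ) (c : ι → ℂ) (i j : ι) :
    ((colMat f c)ᴴ * colMat f c) i j = if f i = f j then star (c i) * c j else 0 := by
  rw [Matrix.mul_apply, Finset.sum_eq_single (f i)]
  · rw [Matrix.conjTranspose_apply, colMat_apply, colMat_apply, if_pos rfl]
    split_ifs <;> simp
  · intro x _ hx
    rw [Matrix.conjTranspose_apply, colMat_apply, if_neg hx, star_zero, zero_mul]
  · simp

theorem isCompact_fiber {E : Type*} [TopologicalSpace E] [T1Space E] {K : Set (E × ℝ)}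
    (hK : IsCompact K) (p : E) : IsCompact {u : ℝ | (p, u) ∈ K} := by
  have : {u : ℝ | (p, u) ∈ K} = Prod.snd '' (K ∩ Prod.fst ⁻¹' {p}) := by
    ext u
    constructor
    · intro hu
      exact ⟨(p, u), ⟨hu, rfl⟩, rfl⟩
    · rintro ⟨⟨q, w⟩, ⟨hq, h⟩, rfl⟩
      obtain rfl : q = p := h
      exact hq
  rw [this]
  exact (hK.inter_right (isClosed_singleton.preimage continuous_fst)).image continuous_snd

namespace Setup

variable {M N : ℕ} (S : Setup M N) {ι : Type} [Fintype ι] [DecidableEq ι]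

/-- The reset to a fixed basis vector x, with Kraus operators |x⟩⟨j|, is incoherent and has diagonal
output. -/
theorem zero_mem_pureValues (ψ : ι → ℂ) : (0 : ℝ) ∈ S.pureValues ψ := by
  let a : Fin M → ℕ := fun _ => 1
  let x : S.Out a := fun i => (S.g i, 0)
  let K : ι → Matrix (S.Out a) ι ℂ := fun j => colMat (fun _ => x) (Pi.single j 1)
  have h := S.sum_objective_mem_pureValues (ν := Unit) (μ := fun _ => ι) (fun _ => a)
    (fun _ => K) (fun _ _ => isSparse_colMat _ _) ?_ ψ
  · rw [Fintype.sum_unique, S.objective_eq_zero_of_isDiag] at h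
    · exact h
    · exact Matrix.posSemidef_sum _ fun _ _ => posSemidef_proj _
    · have hzero : ∀ j y, y ≠ x → (K j *ᵥ ψ) y = 0 := by
        intro j y hy
        refine Finset.sum_eq_zero fun i _ => ?_
        simp only [K, colMat_apply, if_neg hy, zero_mul]
      intro y z hyz
      rw [Matrix.sum_apply]
      refine Finset.sum_eq_zero fun j _ => ?_
      rw [proj, Matrix.vecMulVec_apply, Pi.star_apply]
      by_cases hy : y = x
      · rw [hzero j z (fun hz => hyz (hy.trans hz.symm)), star_zero, mul_zero]
      · rw [hzero j y hy, zero_mul]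
  · rw [Fintype.sum_unique]
    ext i j
    rw [Matrix.sum_apply]
    simp only [K, conjTranspose_colMat_mul_self_apply, if_true]
    rw [Finset.sum_eq_single i]
    · rw [Matrix.one_apply, Pi.single_eq_same, star_one, one_mul, Pi.single_apply]
      simp only [eq_comm]
    · intro n _ hn
      rw [Pi.single_eq_of_ne hn.symm, star_zero, zero_mul]
    · simp

/-- The normalized branches of incoherent operations, with their contributions to the completeness
relation and to the objective. -/
def branchPoints (ψ : ι → ℂ) : Set (Matrix ι ι ℂ × ℝ) :=
  ⋃ t : S.Pattern ι, (fun c : ι → ℂ =>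
    ((colMat t.2 c)ᴴ * colMat t.2 c, S.branchValue t c ψ)) '' {c | IsPure c}

theorem isCompact_branchPoints (ψ : ι → ℂ) : IsCompact (S.branchPoints ψ) := by
  unfold branchPoints
  refine isCompact_iUnion fun t => ?_
  have h1 : Continuous fun c : ι → ℂ => (colMat t.2 c)ᴴ * colMat t.2 c := by
    unfold colMat
    fun_prop
  have h2 := (S.continuous_branchValue t).comp
    (by fun_prop : Continuous fun c : ι → ℂ => (c, ψ))
  simp only [Function.comp_def] at h2
  exact (isCompact_setOf_isPure ι).image (h1.prodMk h2)

/-! ### The maximum over operations as the top of a fibre -/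

theorem isCompact_convexHull_branchPoints (ψ : ι → ℂ) :
    IsCompact (convexHull ℝ (S.branchPoints ψ)) :=
  isCompact_convexHull_of_finiteDimensional (S.isCompact_branchPoints ψ)

/-- The trace of the completeness relation shows that the squared norms of the coefficient vectors
sum to card ι; divided by card ι they are convex weights. Subadditivity gives the inequality. -/
theorem exists_le_of_mem_pureValues [Nonempty ι] {ψ : ι → ℂ} {v : ℝ} (hv : v ∈ S.pureValues ψ) :
    ∃ u, ((Fintype.card ι : ℝ)⁻¹ • (1 : Matrix ι ι ℂ), u) ∈ convexHull ℝ (S.branchPoints ψ) ∧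
      v ≤ Fintype.card ι * u := by
  obtain ⟨a, Φ, ⟨r, K, hK, hΦ⟩, rfl⟩ := hv
  -- An empty output system would make the sum of all KᴴK zero instead of 1.
  have hne : Nonempty (S.Out a) := by
    by_contra hemp
    rw [not_nonempty_iff] at hemp
    let j := Classical.arbitrary ι
    have := congrFun (congrFun hK.1 j) j
    rw [Matrix.sum_apply] at this
    simp [Matrix.mul_apply] at this
  choose t c hc hval using fun n => S.exists_branchValue_of_isSparse a (hK.isSparse n)
  choose s u hu hcu hs using fun n => exists_isPure_smul (c n)
  have hd : (0 : ℝ) < Fintype.card ι := by exact_mod_cast Fintype.card_pos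
  have hsum : ∑ n, ‖s n‖ ^ 2 = Fintype.card ι := by
    have h1 : ∑ n, ((K n)ᴴ * K n).trace = (Fintype.card ι : ℂ) := by
      rw [← Matrix.trace_sum, hK.1, Matrix.trace_one]
    have h2 : ∀ n, ((K n)ᴴ * K n).trace = ((‖s n‖ ^ 2 : ℝ) : ℂ) := by
      intro n
      rw [hc, trace_conjTranspose_mul_colMat, hs]
    simp only [h2] at h1
    exact_mod_cast h1
  let z : Fin r → Matrix ι ι ℂ × ℝ := fun n =>
    ((colMat (t n).2 (u n))ᴴ * colMat (t n).2 (u n), S.branchValue (t n) (u n) ψ)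
  have hz : ∀ n, z n ∈ S.branchPoints ψ := fun n => Set.mem_iUnion.2 ⟨t n, u n, hu n, rfl⟩
  have hmem : ∑ n, ((Fintype.card ι : ℝ)⁻¹ * ‖s n‖ ^ 2) • z n ∈
      convexHull ℝ (S.branchPoints ψ) := by
    refine (convex_convexHull ℝ _).sum_mem (fun n _ => by positivity) ?_
      (fun n _ => subset_convexHull ℝ _ (hz n))
    rw [← Finset.mul_sum, hsum, inv_mul_cancel₀ hd.ne']
  refine ⟨(∑ n, ((Fintype.card ι : ℝ)⁻¹ * ‖s n‖ ^ 2) • z n).2, ?_, ?_⟩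
  · convert hmem using 1
    refine Prod.ext ?_ rfl
    rw [Prod.fst_sum]
    simp only [Prod.smul_fst, mul_smul, ← Finset.smul_sum]
    congr 1
    rw [← hK.1]
    refine Finset.sum_congr rfl fun n _ => ?_
    simp only [z]
    rw [hc n, hcu n, colMat_smul, Matrix.conjTranspose_smul, Matrix.smul_mul, Matrix.mul_smul,
      smul_smul, Complex.star_def, Complex.conj_mul']
    ext x y
    simp [Complex.real_smul]
  · rw [Prod.snd_sum]
    simp only [Prod.smul_snd, smul_eq_mul, mul_assoc, ← Finset.mul_sum]
    rw [mul_inv_cancel_left₀ hd.ne', hΦ]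
    refine (S.objective_sum_le _ a fun n _ =>
      (posSemidef_proj ψ).mul_mul_conjTranspose_same (K n)).trans (le_of_eq ?_)
    refine Finset.sum_congr rfl fun n _ => ?_
    rw [conj_proj, hval n ψ]
    conv_lhs => rw [hcu n]
    rw [branchValue_smul_left]

/-- Conversely, scaling the branches by the square roots of card ι times the weights restores
completeness, and flags make their values add up exactly. -/
theorem mul_mem_pureValues [Nonempty ι] {ψ : ι → ℂ} {u : ℝ}
    (hu : ((Fintype.card ι : ℝ)⁻¹ • (1 : Matrix ι ι ℂ), u) ∈ convexHull ℝ (S.branchPoints ψ)) :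
    Fintype.card ι * u ∈ S.pureValues ψ := by
  have hd : (0 : ℝ) < Fintype.card ι := by exact_mod_cast Fintype.card_pos
  obtain ⟨ν, _, z, w, hz, -, hw, -, hsum⟩ := eq_pos_convex_span_of_mem_convexHull hu
  classical
  have hz' : ∀ n, ∃ (t : S.Pattern ι) (c : ι → ℂ),
      z n = ((colMat t.2 c)ᴴ * colMat t.2 c, S.branchValue t c ψ) := by
    intro n
    obtain ⟨t, c, -, h⟩ := Set.mem_iUnion.1 (hz ⟨n, rfl⟩)
    exact ⟨t, c, h.symm⟩
  choose t c htc using hz'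
  let s : ν → ℂ := fun n => (Real.sqrt (Fintype.card ι * w n) : ℂ)
  have hs : ∀ n, ‖s n‖ ^ 2 = Fintype.card ι * w n := by
    intro n
    simp only [s]
    rw [Complex.norm_real, Real.norm_eq_abs, sq_abs, Real.sq_sqrt]
    exact mul_nonneg hd.le (hw n).le
  have h := S.sum_objective_mem_pureValues (ν := ν) (μ := fun _ => Unit)
    (fun n i => ((t n).1 i : ℕ)) (fun n _ => colMat (t n).2 (s n • c n))
    (fun _ _ => isSparse_colMat _ _) ?_ ψ
  · convert h using 1
    have h2 := congrArg Prod.snd hsum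
    rw [Prod.snd_sum] at h2
    simp only [Prod.smul_snd, smul_eq_mul, htc] at h2
    rw [← h2, Finset.mul_sum]
    refine Finset.sum_congr rfl fun n _ => ?_
    rw [Fintype.sum_unique, ← mul_assoc, ← hs, ← branchValue_smul_left]
    rfl
  · have h1 := congrArg Prod.fst hsum
    rw [Prod.fst_sum] at h1
    simp only [Prod.smul_fst, htc] at h1
    have h3 : (1 : Matrix ι ι ℂ) = (Fintype.card ι : ℝ) • ((Fintype.card ι : ℝ)⁻¹ • 1) := by
      rw [smul_smul, mul_inv_cancel₀ hd.ne', one_smul]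
    rw [h3, ← h1, Finset.smul_sum]
    refine Finset.sum_congr rfl fun n _ => ?_
    rw [Fintype.sum_unique, colMat_smul, Matrix.conjTranspose_smul, Matrix.smul_mul,
      Matrix.mul_smul, smul_smul, smul_smul, Complex.star_def, Complex.conj_mul', ← hs]
    ext x y
    simp [Complex.real_smul]

theorem isGreatest_pureCSF [Nonempty ι] (ψ : ι → ℂ) :
    IsGreatest (S.pureValues ψ) (S.pureCSF ψ) := by
  have hd : (0 : ℝ) ≤ Fintype.card ι := by positivity
  obtain ⟨u₀, hu₀, -⟩ := S.exists_le_of_mem_pureValues (S.zero_mem_pureValues ψ)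
  obtain ⟨u, hu, hmax⟩ := (isCompact_fiber (S.isCompact_convexHull_branchPoints ψ)
    ((Fintype.card ι : ℝ)⁻¹ • (1 : Matrix ι ι ℂ))).exists_isGreatest ⟨u₀, hu₀⟩
  have hg : IsGreatest (S.pureValues ψ) (Fintype.card ι * u) := by
    refine ⟨S.mul_mem_pureValues hu, fun v hv => ?_⟩
    obtain ⟨u', hu', hle⟩ := S.exists_le_of_mem_pureValues hv
    exact hle.trans (mul_le_mul_of_nonneg_left (hmax hu') hd)
  rw [pureCSF, hg.csSup_eq]
  exact hg

theorem pureCSF_nonneg [Nonempty ι] (ψ : ι → ℂ) : 0 ≤ S.pureCSF ψ :=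
  (S.isGreatest_pureCSF ψ).2 (S.zero_mem_pureValues ψ)

/-- There are finitely many patterns, and each branch value is continuous on the compact set of
pairs of unit vectors. Uniformity in ψ is what later allows truncating the epigraph. -/
theorem exists_pureCSF_le (ι : Type) [Fintype ι] [DecidableEq ι] [Nonempty ι] :
    ∃ B : ℝ, ∀ ψ : ι → ℂ, IsPure ψ → S.pureCSF ψ ≤ B := by
  have hcpt := (isCompact_setOf_isPure ι).prod (isCompact_setOf_isPure ι)
  have hB : ∀ t : S.Pattern ι, ∃ B : ℝ, ∀ c ψ : ι → ℂ, IsPure c → IsPure ψ →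
      S.branchValue t c ψ ≤ B := by
    intro t
    obtain ⟨B, hB⟩ := (hcpt.image (S.continuous_branchValue t)).bddAbove
    exact ⟨B, fun c ψ hc hψ => hB ⟨(c, ψ), ⟨hc, hψ⟩, rfl⟩⟩
  choose B hB using hB
  obtain ⟨B₀, hB₀⟩ := Finite.exists_le B
  refine ⟨Fintype.card ι * B₀, fun ψ hψ => ?_⟩
  obtain ⟨u, hu, hle⟩ := S.exists_le_of_mem_pureValues (S.isGreatest_pureCSF ψ).1
  refine hle.trans (mul_le_mul_of_nonneg_left ?_ (by positivity))
  have hsub : S.branchPoints ψ ⊆ {q : Matrix ι ι ℂ × ℝ | q.2 ≤ B₀} := by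
    intro q hq
    obtain ⟨t, c, hc, rfl⟩ := Set.mem_iUnion.1 hq
    exact (hB t c ψ hc hψ).trans (hB₀ t)
  have hconv : Convex ℝ {q : Matrix ι ι ℂ × ℝ | q.2 ≤ B₀} :=
    convex_halfSpace_le (LinearMap.isLinear (LinearMap.snd ℝ (Matrix ι ι ℂ) ℝ)) B₀
  exact convexHull_min hsub hconv hu

theorem pureCSF_smul (s : ℂ) (ψ : ι → ℂ) : S.pureCSF (s • ψ) = ‖s‖ ^ 2 * S.pureCSF ψ := by
  have h : S.pureValues (s • ψ) = (fun v => ‖s‖ ^ 2 * v) '' S.pureValues ψ := by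
    have key : ∀ (a : Fin M → ℕ) (Φ : Matrix ι ι ℂ → Matrix (S.Out a) (S.Out a) ℂ), IsICPTP Φ →
        S.objective a (Φ (proj (s • ψ))) = ‖s‖ ^ 2 * S.objective a (Φ (proj ψ)) := by
      intro a Φ hΦ
      rw [proj_smul, hΦ.map_smul, S.objective_smul a (hΦ.posSemidef (posSemidef_proj ψ))
        (by positivity)]
    ext v
    constructor
    · rintro ⟨a, Φ, hΦ, rfl⟩
      exact ⟨_, ⟨a, Φ, hΦ, rfl⟩, (key a Φ hΦ).symm⟩
    · rintro ⟨_, ⟨a, Φ, hΦ, rfl⟩, rfl⟩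
      exact ⟨a, Φ, hΦ, (key a Φ hΦ).symm⟩
  rw [pureCSF, h, pureCSF]
  exact Real.sSup_smul_of_nonneg (sq_nonneg ‖s‖) (S.pureValues ψ)

/-- This is lower semicontinuity: a maximum of continuous functions has an intersection of closed
epigraphs. -/
theorem isClosed_epigraph_pureCSF [Nonempty ι] :
    IsClosed {q : (ι → ℂ) × ℝ | S.pureCSF q.1 ≤ q.2} := by
  have h : {q : (ι → ℂ) × ℝ | S.pureCSF q.1 ≤ q.2} =
      ⋂ (a : Fin M → ℕ) (Φ : Matrix ι ι ℂ → Matrix (S.Out a) (S.Out a) ℂ) (_ : IsICPTP Φ),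
        {q : (ι → ℂ) × ℝ | S.objective a (Φ (proj q.1)) ≤ q.2} := by
    ext q
    simp only [Set.mem_ofPred_eq, Set.mem_iInter]
    constructor
    · intro hq a Φ hΦ
      exact ((S.isGreatest_pureCSF q.1).2 ⟨a, Φ, hΦ, rfl⟩).trans hq
    · intro hq
      obtain ⟨a, Φ, hΦ, hv⟩ := (S.isGreatest_pureCSF q.1).1
      rw [hv]
      exact hq a Φ hΦ
  rw [h]
  refine isClosed_iInter fun a => isClosed_iInter fun Φ => isClosed_iInter fun hΦ => ?_
  obtain ⟨G, hG, hGeq⟩ := S.exists_continuous_eq_objective a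
  have : (fun q : (ι → ℂ) × ℝ => S.objective a (Φ (proj q.1))) = fun q => G (Φ (proj q.1)) :=
    funext fun q => hGeq _ (hΦ.posSemidef (posSemidef_proj _))
  refine isClosed_le ?_ continuous_snd
  rw [this]
  exact hG.comp (hΦ.continuous.comp (continuous_proj.comp continuous_fst))

/-- Follow outcome n by the optimal operation for its unnormalized vector and flag n: this is one
admissible operation on ψ, and its value is the left side. -/
theorem sum_pureCSF_le [Nonempty ι] {κ : Type} [Fintype κ] [DecidableEq κ] [Nonempty κ] {r : ℕ}
    {K : Fin r → Matrix κ ι ℂ} (hK : IsIncoherentKraus K) (ψ : ι → ℂ) :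
    ∑ n, S.pureCSF (K n *ᵥ ψ) ≤ S.pureCSF ψ := by
  choose a Φ hΦ hval using fun n => (S.isGreatest_pureCSF (K n *ᵥ ψ)).1
  choose r' L hL hΦL using hΦ
  have h := S.sum_objective_mem_pureValues (ν := Fin r) (μ := fun n => Fin (r' n)) a
    (fun n m => L n m * K n) (fun n m => ((hL n).isSparse m).mul (hK.isSparse n)) ?_ ψ
  · refine le_trans (le_of_eq ?_) ((S.isGreatest_pureCSF ψ).2 h)
    refine Finset.sum_congr rfl fun n _ => ?_
    rw [hval, hΦL]
    congr 1
    refine Finset.sum_congr rfl fun m _ => ?_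
    rw [conj_proj, Matrix.mulVec_mulVec]
  · rw [← hK.1]
    refine Finset.sum_congr rfl fun n _ => ?_
    calc ∑ m, (L n m * K n)ᴴ * (L n m * K n) = (K n)ᴴ * (∑ m, (L n m)ᴴ * L n m) * K n := by
          rw [Matrix.mul_sum, Matrix.sum_mul]
          refine Finset.sum_congr rfl fun m _ => ?_
          simp only [Matrix.conjTranspose_mul, Matrix.mul_assoc]
      _ = (K n)ᴴ * K n := by rw [(hL n).1, Matrix.mul_one]

theorem pureCSF_eq_zero_of_isDiag [Nonempty ι] {ψ : ι → ℂ} (h : (proj ψ).IsDiag) :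
    S.pureCSF ψ = 0 := by
  obtain ⟨a, Φ, hΦ, hv⟩ := (S.isGreatest_pureCSF ψ).1
  rw [hv]
  exact S.objective_eq_zero_of_isDiag a (hΦ.posSemidef (posSemidef_proj ψ)) (hΦ.isDiag h)

/-! ### Faithfulness on pure states -/

theorem funMat_mulVec_apply_of_injective {α β : Type} [Fintype α] [Fintype β] [DecidableEq α]
    [DecidableEq β] {f : α → β} (hf : Function.Injective f) (ψ : α → ℂ) (j : α) :
    (funMat f *ᵥ ψ) (f j) = ψ j := by
  simp [Matrix.mulVec, dotProduct, funMat, hf.eq_iff]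

theorem exists_eq_of_funMat_mulVec_ne_zero {α β : Type} [Fintype α] [Fintype β] [DecidableEq α]
    [DecidableEq β] {f : α → β} {ψ : α → ℂ} {y : β} (h : (funMat f *ᵥ ψ) y ≠ 0) :
    ∃ j, y = f j := by
  by_contra hne
  push Not at hne
  refine h (Finset.sum_eq_zero fun j _ => ?_)
  simp [funMat, hne j]

theorem exists_of_proj_funMat_mulVec_ne_zero {α β : Type} [Fintype α] [Fintype β] [DecidableEq α]
    [DecidableEq β] {f : α → β} {ψ : α → ℂ} {x y : β} (h : proj (funMat f *ᵥ ψ) x y ≠ 0) :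
    ∃ j l, x = f j ∧ y = f l := by
  rw [proj, Matrix.vecMulVec_apply, Pi.star_apply] at h
  obtain ⟨j, hj⟩ := exists_eq_of_funMat_mulVec_ne_zero (left_ne_zero_of_mul h)
  obtain ⟨l, hl⟩ := exists_eq_of_funMat_mulVec_ne_zero
    (star_ne_zero.1 (right_ne_zero_of_mul h))
  exact ⟨j, l, hj, hl⟩

theorem exists_level_ne (i : Fin M) (k : Fin N) : ∃ u v, S.h i k u u ≠ S.h i k v v := by
  by_contra hne
  push Not at hne
  refine S.h_nontrivial i k (S.h i k (S.g i k) (S.g i k)) ?_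
  ext u v
  rw [Matrix.smul_apply, smul_eq_mul, Matrix.one_apply]
  split_ifs with huv
  · rw [mul_one, ← huv, hne u]
  · rw [mul_zero]
    exact S.h_isDiag i k huv

/-- A coherent pure state has a positive joint quantity. The operation that shows it stores the basis
label in the ancillary particles of one collection, except that the labels `a` and `b` are
distinguished only by the energy of one particle. -/
theorem pureCSF_pos (hM : 1 ≤ M) (hN : 1 ≤ N) {ψ : ι → ℂ} {a b : ι} (hab : a ≠ b) (ha : ψ a ≠ 0)
    (hb : ψ b ≠ 0) : 0 < S.pureCSF ψ := by
  have : Nonempty ι := ⟨a⟩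
  let i₀ : Fin M := ⟨0, hM⟩
  let k₀ : Fin N := ⟨0, hN⟩
  obtain ⟨u, v, huv⟩ := S.exists_level_ne i₀ k₀
  let d : Fin M → ℕ := fun _ => Fintype.card ι
  let E : ι ≃ Fin (Fintype.card ι) := Fintype.equivFin ι
  let p : Fin (S.dim i₀ k₀) → ∀ k, Fin (S.dim i₀ k) := fun w => Function.update (S.g i₀) k₀ w
  -- The label b borrows the ancilla label of a and is told apart by level v; all other labels have
  -- level u, which keeps φ injective.
  let φ : ι → S.Cell d i₀ := fun j => if j = b then (p v, E a) else (p u, E j)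
  let f : ι → S.Out d := fun j => Function.update (fun i => (S.g i, E a)) i₀ (φ j)
  have hp : p u ≠ p v := by
    intro h
    have := congrFun h k₀
    simp only [p, Function.update_self] at this
    exact huv (by rw [this])
  have hφ : Function.Injective φ := by
    intro j l hjl
    simp only [φ] at hjl
    split_ifs at hjl with h1 h2 h2
    · rw [h1, h2]
    · exact absurd (congrArg Prod.fst hjl).symm hp
    · exact absurd (congrArg Prod.fst hjl) hp
    · exact E.injective (congrArg Prod.snd hjl)
  have hfi : ∀ j, f j i₀ = φ j := fun j => Function.update_self _ _ _
  have hf : Function.Injective f := fun j l hjl => hφ (by rw [← hfi, hjl, hfi])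
  have hmem : S.objective d (proj (funMat f *ᵥ ψ)) ∈ S.pureValues ψ := by
    have h := S.sum_objective_mem_pureValues (ν := Unit) (μ := fun _ => Unit) (fun _ => d)
      (fun _ _ => funMat f) (fun _ _ => isSparse_funMat f)
      (by rw [Fintype.sum_unique, Fintype.sum_unique, conjTranspose_funMat_mul_self hf]) ψ
    rwa [Fintype.sum_unique, Fintype.sum_unique] at h
  refine lt_of_lt_of_le ?_ ((S.isGreatest_pureCSF ψ).2 hmem)
  rw [objective_eq]
  have hred : reduceTo (τ := S.Cell d) i₀ (proj (funMat f *ᵥ ψ)) = proj (funMat φ *ᵥ ψ) := by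
    rw [Matrix.ext_iff_trace_mul_right]
    intro B
    have hcyc : ∀ {α β : Type} [Fintype α] [Fintype β] (V : Matrix β α ℂ) (X : Matrix α α ℂ)
        (Y : Matrix β β ℂ), (V * X * Vᴴ * Y).trace = (X * (Vᴴ * Y * V)).trace := by
      intro α β _ _ V X Y
      rw [Matrix.mul_assoc, Matrix.mul_assoc, Matrix.trace_mul_comm]
      simp only [Matrix.mul_assoc]
    rw [trace_reduceTo_mul, ← conj_proj, ← conj_proj, hcyc, hcyc, conjTranspose_funMat_mul_mul,
      conjTranspose_funMat_mul_mul]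
    congr 2
    ext j l
    rw [Matrix.submatrix_apply, Matrix.submatrix_apply, onFactor, Matrix.of_apply, if_pos, hfi,
      hfi]
    intro i hi
    simp only [f, Function.update_of_ne hi]
  -- The other collections sit in one fixed basis vector.
  have hother : ∀ i, i ≠ i₀ → S.cellValue d i
      (reduceTo (τ := S.Cell d) i (proj (funMat f *ᵥ ψ))) = 0 := by
    intro i hi
    refine S.cellValue_eq_zero_of_isDiag d i (posSemidef_reduceTo i (posSemidef_proj _)) ?_
    intro x y hxy
    simp only [reduceTo, Matrix.of_apply]
    refine Finset.sum_eq_zero fun z _ => ?_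
    split_ifs with hz
    · by_contra hne
      obtain ⟨j, l, h1, h2⟩ := exists_of_proj_funMat_mulVec_ne_zero hne
      have h1' := congrFun h1 i
      have h2' := congrFun h2 i
      simp only [f, Function.update_of_ne hi, Function.update_self] at h1' h2'
      exact hxy (by rw [← hz, h1', h2'])
    · rfl
  rw [Finset.sum_eq_single i₀ (fun i _ hi => hother i hi) (by simp), hred, cellValue,
    S.trace_mul_exchange_eq_zero d i₀]
  · rw [Complex.zero_re, add_zero]
    have hnn := qfi_nonneg (posSemidef_proj (funMat φ *ᵥ ψ))
      (S.hamiltonian i₀ ⊗ₖ (1 : Matrix (Fin (d i₀)) (Fin (d i₀)) ℂ))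
    refine mul_pos (by norm_num) (lt_of_le_of_ne hnn fun h0 => ?_)
    have hcomm := commute_of_qfi_eq_zero (posSemidef_proj _) h0.symm
    rw [hamiltonian_kronecker_one_eq_diagonal] at hcomm
    have hentry := congrFun (congrFun hcomm (φ a)) (φ b)
    rw [Matrix.mul_diagonal, Matrix.diagonal_mul, mul_comm] at hentry
    have hne : proj (funMat φ *ᵥ ψ) (φ a) (φ b) ≠ 0 := by
      rw [proj, Matrix.vecMulVec_apply, Pi.star_apply, funMat_mulVec_apply_of_injective hφ,
        funMat_mulVec_apply_of_injective hφ]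
      exact mul_ne_zero ha (star_ne_zero.2 hb)
    -- Commutation at a nonzero coherence forces equal total energies of φ a and φ b, which differ
    -- only at particle k₀.
    have hsum := mul_right_cancel₀ hne hentry
    have hφa : φ a = (p u, E a) := if_neg hab
    have hφb : φ b = (p v, E a) := if_pos rfl
    rw [hφa, hφb] at hsum
    simp only at hsum
    rw [← Finset.add_sum_erase _ _ (Finset.mem_univ k₀),
      ← Finset.add_sum_erase (Finset.univ) (fun k => S.h i₀ k (p u k) (p u k))
        (Finset.mem_univ k₀)] at hsum
    have hrest : ∑ k ∈ Finset.univ.erase k₀, S.h i₀ k (p v k) (p v k) =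
        ∑ k ∈ Finset.univ.erase k₀, S.h i₀ k (p u k) (p u k) := by
      refine Finset.sum_congr rfl fun k hk => ?_
      have hk' := Finset.ne_of_mem_erase hk
      simp only [p, Function.update_of_ne hk']
    rw [hrest] at hsum
    have h3 := add_right_cancel hsum
    simp only [p, Function.update_self] at h3
    exact huv h3.symm
  -- Of any two distinct particles one is not k₀, and it is in its ground state for every label.
  · intro x y hxy
    obtain ⟨j, l, rfl, rfl⟩ := exists_of_proj_funMat_mulVec_ne_zero hxy
    have hoff : ∀ j k, k ≠ k₀ → (φ j).1 k = S.g i₀ k := by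
      intro j k hk
      simp only [φ]
      split_ifs
      · simp only [p, Function.update_of_ne hk]
      · simp only [p, Function.update_of_ne hk]
    intro k k' hkk
    by_cases hk : k = k₀
    · have hk' : k' ≠ k₀ := fun h => hkk (hk.trans h.symm)
      exact Or.inr (by rw [hoff _ _ hk', hoff _ _ hk'])
    · exact Or.inl (by rw [hoff _ _ hk, hoff _ _ hk])

theorem isDiag_proj_of_pureCSF_eq_zero (hM : 1 ≤ M) (hN : 1 ≤ N) {ψ : ι → ℂ}
    (h : S.pureCSF ψ = 0) : (proj ψ).IsDiag := by
  intro a b hab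
  rw [proj, Matrix.vecMulVec_apply, Pi.star_apply]
  by_contra hne
  exact (S.pureCSF_pos hM hN hab (left_ne_zero_of_mul hne)
    (star_ne_zero.1 (right_ne_zero_of_mul hne))).ne' h

end Setup

/-! ### The convex roof -/

theorem IsState.nonempty {ι : Type} [Fintype ι] [DecidableEq ι] {ρ : Matrix ι ι ℂ}
    (hρ : IsState ρ) : Nonempty ι := by
  by_contra h
  rw [not_nonempty_iff] at h
  have := hρ.2
  simp [Matrix.trace] at this

open scoped MatrixOrder in
theorem exists_sum_proj_eq {ι : Type} [Fintype ι] [DecidableEq ι] {ρ : Matrix ι ι ℂ}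
    (hρ : ρ.PosSemidef) : ∃ φ : ι → ι → ℂ, ρ = ∑ m, proj (φ m) := by
  obtain ⟨B, rfl⟩ : ∃ B : Matrix ι ι ℂ, ρ = Bᴴ * B :=
    CStarAlgebra.nonneg_iff_eq_star_mul_self.mp hρ.nonneg
  refine ⟨fun m i => star (B m i), ?_⟩
  ext i j
  rw [Matrix.mul_apply, Matrix.sum_apply]
  refine Finset.sum_congr rfl fun m _ => ?_
  simp [proj, Matrix.vecMulVec_apply]

theorem IsIncoherentKraus.isState_sum {ι κ : Type} [Fintype ι] [DecidableEq ι] [Fintype κ]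
    [DecidableEq κ] {r : ℕ} {K : Fin r → Matrix κ ι ℂ} (hK : IsIncoherentKraus K)
    {ρ : Matrix ι ι ℂ} (hρ : IsState ρ) : IsState (∑ n, K n * ρ * (K n)ᴴ) := by
  refine ⟨Matrix.posSemidef_sum _ fun n _ => hρ.1.mul_mul_conjTranspose_same (K n), ?_⟩
  have h : ∀ n, (K n * ρ * (K n)ᴴ).trace = ((K n)ᴴ * K n * ρ).trace := fun n =>
    Matrix.trace_mul_cycle _ _ _
  rw [Matrix.trace_sum]
  simp only [h]
  rw [← Matrix.trace_sum, ← Matrix.sum_mul, hK.1, Matrix.one_mul, hρ.2]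

theorem isDiag_proj_single {ι : Type} [Fintype ι] [DecidableEq ι] (j : ι) (c : ℂ) :
    (proj (Pi.single j c)).IsDiag := by
  intro x y hxy
  rw [proj, Matrix.vecMulVec_apply, Pi.star_apply]
  by_cases hx : x = j
  · rw [Pi.single_eq_of_ne (fun hy : y = j => hxy (hx.trans hy.symm)), star_zero, mul_zero]
  · rw [Pi.single_eq_of_ne hx, zero_mul]

theorem norm_sqrt_sq {t : ℝ} (ht : 0 ≤ t) : ‖((Real.sqrt t : ℝ) : ℂ)‖ ^ 2 = t := by
  rw [Complex.norm_real, Real.norm_eq_abs, sq_abs, Real.sq_sqrt ht]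

namespace Setup

variable {M N : ℕ} (S : Setup M N) {ι : Type} [Fintype ι] [DecidableEq ι]

theorem weightedSum_mem_roofValues {ν : Type} [Fintype ν] {ρ : Matrix ι ι ℂ} (p : ν → ℝ)
    (ψ : ν → ι → ℂ) (hp : ∀ m, 0 ≤ p m) (hp1 : ∑ m, p m = 1) (hψ : ∀ m, IsPure (ψ m))
    (hρ : ρ = ∑ m, p m • proj (ψ m)) : ∑ m, p m * S.pureCSF (ψ m) ∈ S.roofValues ρ := by
  let e := (Fintype.equivFin ν).symm
  refine ⟨Fintype.card ν, fun m => p (e m), fun m => ψ (e m), fun m => hp _, ?_, fun m => hψ _,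
    ?_, ?_⟩
  · rw [← hp1]
    exact Equiv.sum_comp e p
  · rw [hρ]
    exact (Equiv.sum_comp e fun m => p m • proj (ψ m)).symm
  · exact (Equiv.sum_comp e fun m => p m * S.pureCSF (ψ m)).symm

/-- By quadratic homogeneity the weights can be absorbed into unnormalized vectors, which makes
decompositions easy to transport through Kraus operators and to concatenate. -/
theorem sum_pureCSF_mem_roofValues {ν : Type} [Fintype ν] {ρ : Matrix ι ι ℂ} (hρ : IsState ρ)
    (φ : ν → ι → ℂ) (h : ρ = ∑ m, proj (φ m)) : ∑ m, S.pureCSF (φ m) ∈ S.roofValues ρ := by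
  have := hρ.nonempty
  choose s u hu hsu hs using fun m => exists_isPure_smul (φ m)
  have hmem := S.weightedSum_mem_roofValues (ρ := ρ) (fun m => ‖s m‖ ^ 2) u
    (fun m => by positivity) ?_ hu ?_
  · convert hmem using 1
    refine Finset.sum_congr rfl fun m _ => ?_
    rw [hsu m, pureCSF_smul]
  · have htr := hρ.2
    rw [h, Matrix.trace_sum] at htr
    simp only [trace_proj, ← hs] at htr
    exact_mod_cast htr
  · rw [h]
    refine Finset.sum_congr rfl fun m _ => ?_
    rw [hsu m, proj_smul]

theorem exists_of_mem_roofValues {ρ : Matrix ι ι ℂ} {v : ℝ} (hv : v ∈ S.roofValues ρ) :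
    ∃ (r : ℕ) (φ : Fin r → ι → ℂ), ρ = ∑ m, proj (φ m) ∧ v = ∑ m, S.pureCSF (φ m) := by
  obtain ⟨r, p, ψ, hp, -, -, hρ, hv⟩ := hv
  refine ⟨r, fun m => ((Real.sqrt (p m) : ℝ) : ℂ) • ψ m, ?_, ?_⟩
  · rw [hρ]
    refine Finset.sum_congr rfl fun m _ => ?_
    rw [proj_smul, norm_sqrt_sq (hp m)]
  · rw [hv]
    refine Finset.sum_congr rfl fun m _ => ?_
    rw [pureCSF_smul, norm_sqrt_sq (hp m)]

/-- The points of the truncated epigraph of the joint quantity over the pure states. -/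
def roofPoints (S : Setup M N) (ι : Type) [Fintype ι] [DecidableEq ι] (B : ℝ) :
    Set (Matrix ι ι ℂ × ℝ) :=
  (fun q : (ι → ℂ) × ℝ => (proj q.1, q.2)) ''
    (({c | IsPure c} ×ˢ Set.Icc 0 B) ∩ {q | S.pureCSF q.1 ≤ q.2})

theorem isCompact_roofPoints [Nonempty ι] (B : ℝ) : IsCompact (S.roofPoints ι B) := by
  have h : Continuous fun q : (ι → ℂ) × ℝ => (proj q.1, q.2) :=
    (continuous_proj.comp continuous_fst).prodMk continuous_snd
  exact (((isCompact_setOf_isPure ι).prod isCompact_Icc).inter_right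
    S.isClosed_epigraph_pureCSF).image h

theorem isLeast_CSF {ρ : Matrix ι ι ℂ} (hρ : IsState ρ) :
    IsLeast (S.roofValues ρ) (S.CSF ρ) := by
  have := hρ.nonempty
  obtain ⟨B, hB⟩ := S.exists_pureCSF_le ι
  have hin : ∀ v ∈ S.roofValues ρ, (ρ, v) ∈ convexHull ℝ (S.roofPoints ι B) := by
    rintro v ⟨r, p, ψ, hp, hp1, hψ, hρ', rfl⟩
    have hmem : ∑ m, p m • ((proj (ψ m), S.pureCSF (ψ m)) : Matrix ι ι ℂ × ℝ) ∈
        convexHull ℝ (S.roofPoints ι B) := by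
      refine (convex_convexHull ℝ _).sum_mem (fun m _ => hp m) hp1
        (fun m _ => subset_convexHull ℝ _ ?_)
      exact ⟨(ψ m, S.pureCSF (ψ m)),
        ⟨⟨hψ m, S.pureCSF_nonneg _, hB _ (hψ m)⟩, le_refl (S.pureCSF (ψ m))⟩, rfl⟩
    convert hmem using 1
    refine Prod.ext ?_ ?_
    · rw [Prod.fst_sum, hρ']
      rfl
    · rw [Prod.snd_sum]
      rfl
  -- Hull points come from the epigraph and may lie above the roof values, so only an inequality is
  -- available; it suffices for the minimum.
  have hout : ∀ u, (ρ, u) ∈ convexHull ℝ (S.roofPoints ι B) → ∃ v ∈ S.roofValues ρ, v ≤ u := by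
    intro u hu
    obtain ⟨ν, _, z, w, hz, -, hw, hw1, hsum⟩ := eq_pos_convex_span_of_mem_convexHull hu
    have hz' : ∀ n, ∃ ψ : ι → ℂ, IsPure ψ ∧ (z n).1 = proj ψ ∧ S.pureCSF ψ ≤ (z n).2 := by
      intro n
      obtain ⟨q, ⟨⟨hq, -⟩, hle⟩, h⟩ := hz ⟨n, rfl⟩
      rw [← h]
      exact ⟨q.1, hq, rfl, hle⟩
    choose ψ hψ hzψ hle using hz'
    refine ⟨_, S.weightedSum_mem_roofValues (ρ := ρ) w ψ (fun m => (hw m).le) hw1 hψ ?_, ?_⟩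
    · have h1 := congrArg Prod.fst hsum
      rw [Prod.fst_sum] at h1
      simp only [Prod.smul_fst, hzψ] at h1
      exact h1.symm
    · have h2 := congrArg Prod.snd hsum
      rw [Prod.snd_sum] at h2
      simp only [Prod.smul_snd, smul_eq_mul] at h2
      rw [← h2]
      exact Finset.sum_le_sum fun m _ => mul_le_mul_of_nonneg_left (hle m) (hw m).le
  obtain ⟨φ, hφ⟩ := exists_sum_proj_eq hρ.1
  obtain ⟨u, hu, hmin⟩ := (isCompact_fiber (isCompact_convexHull_of_finiteDimensional
    (S.isCompact_roofPoints (ι := ι) B)) ρ).exists_isLeast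
      ⟨_, hin _ (S.sum_pureCSF_mem_roofValues hρ φ hφ)⟩
  obtain ⟨v, hv, hvu⟩ := hout u hu
  have hl : IsLeast (S.roofValues ρ) v := ⟨hv, fun v' hv' => hvu.trans (hmin (hin v' hv'))⟩
  rw [CSF, hl.csInf_eq]
  exact hl

theorem CSF_le_sum {ν : Type} [Fintype ν] {ρ : Matrix ι ι ℂ} (hρ : IsState ρ)
    (φ : ν → ι → ℂ) (h : ρ = ∑ m, proj (φ m)) : S.CSF ρ ≤ ∑ m, S.pureCSF (φ m) :=
  (S.isLeast_CSF hρ).2 (S.sum_pureCSF_mem_roofValues hρ φ h)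

theorem exists_CSF_eq {ρ : Matrix ι ι ℂ} (hρ : IsState ρ) :
    ∃ (r : ℕ) (φ : Fin r → ι → ℂ), ρ = ∑ m, proj (φ m) ∧ S.CSF ρ = ∑ m, S.pureCSF (φ m) :=
  S.exists_of_mem_roofValues (S.isLeast_CSF hρ).1

/-! ### The axioms -/

theorem CSF_nonneg {ρ : Matrix ι ι ℂ} (hρ : IsState ρ) : 0 ≤ S.CSF ρ := by
  have := hρ.nonempty
  obtain ⟨r, φ, -, h⟩ := S.exists_CSF_eq hρ
  rw [h]
  exact Finset.sum_nonneg fun m _ => S.pureCSF_nonneg _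

theorem CSF_eq_zero_iff (hM : 1 ≤ M) (hN : 1 ≤ N) {ρ : Matrix ι ι ℂ} (hρ : IsState ρ) :
    S.CSF ρ = 0 ↔ IsIncoherent ρ := by
  have := hρ.nonempty
  constructor
  · intro h0
    -- Here attainment of the minimum matters: every vector of an optimal decomposition has value 0
    -- and hence is incoherent.
    obtain ⟨r, φ, hφ, h⟩ := S.exists_CSF_eq hρ
    rw [h, Finset.sum_eq_zero_iff_of_nonneg fun m _ => S.pureCSF_nonneg _] at h0
    refine ⟨hρ, fun x y hxy => ?_⟩
    change ρ x y = 0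
    rw [hφ, Matrix.sum_apply]
    exact Finset.sum_eq_zero fun m hm =>
      S.isDiag_proj_of_pureCSF_eq_zero hM hN (h0 m hm) hxy
  · rintro ⟨-, hd⟩
    have hre : ∀ j, 0 ≤ (ρ j j).re := fun j => (Complex.nonneg_iff.1 hρ.1.diag_nonneg).1
    have him : ∀ j, ((ρ j j).re : ℂ) = ρ j j := fun j =>
      Complex.ext rfl (Complex.nonneg_iff.1 hρ.1.diag_nonneg).2
    have hdec : ρ = ∑ j, proj (Pi.single j ((Real.sqrt (ρ j j).re : ℝ) : ℂ)) := by
      ext x y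
      rw [Matrix.sum_apply]
      by_cases hxy : x = y
      · subst hxy
        rw [Finset.sum_eq_single x]
        · rw [proj, Matrix.vecMulVec_apply, Pi.star_apply, Pi.single_eq_same, Complex.star_def,
            Complex.mul_conj', ← Complex.ofReal_pow, norm_sqrt_sq (hre x), him]
        · intro j _ hj
          rw [proj, Matrix.vecMulVec_apply, Pi.single_eq_of_ne hj.symm, zero_mul]
        · simp
      · rw [hd hxy]
        exact (Finset.sum_eq_zero fun j _ => isDiag_proj_single j _ hxy).symm
    refine le_antisymm ((S.CSF_le_sum hρ _ hdec).trans (le_of_eq ?_)) (S.CSF_nonneg hρ)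
    exact Finset.sum_eq_zero fun j _ => S.pureCSF_eq_zero_of_isDiag (isDiag_proj_single j _)

variable {κ : Type} [Fintype κ] [DecidableEq κ]

theorem sum_sum_pureCSF_le {r q : ℕ} {K : Fin r → Matrix κ ι ℂ} (hK : IsIncoherentKraus K)
    {ρ : Matrix ι ι ℂ} (hρ : IsState ρ) (φ : Fin q → ι → ℂ) :
    ∑ n, ∑ m, S.pureCSF (K n *ᵥ φ m) ≤ ∑ m, S.pureCSF (φ m) := by
  have := hρ.nonempty
  have := (hK.isState_sum hρ).nonempty
  rw [Finset.sum_comm]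
  exact Finset.sum_le_sum fun m _ => S.sum_pureCSF_le hK (φ m)

/-- The images of an optimal decomposition under all Kraus operators together decompose the output.
-/
theorem CSF_map_le {Φ : Matrix ι ι ℂ → Matrix κ κ ℂ} (hΦ : IsICPTP Φ) {ρ : Matrix ι ι ℂ}
    (hρ : IsState ρ) : S.CSF (Φ ρ) ≤ S.CSF ρ := by
  obtain ⟨r, K, hK, h⟩ := hΦ
  obtain ⟨q, φ, hφ, hval⟩ := S.exists_CSF_eq hρ
  have hstate := hK.isState_sum hρ
  rw [h, hval]
  refine (S.CSF_le_sum hstate (fun x : Fin r × Fin q => K x.1 *ᵥ φ x.2) ?_).trans ?_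
  · rw [Fintype.sum_prod_type]
    refine Finset.sum_congr rfl fun n _ => ?_
    simp only [← conj_proj]
    rw [← Matrix.sum_mul, ← Matrix.mul_sum, ← hφ]
  · rw [Fintype.sum_prod_type]
    exact S.sum_sum_pureCSF_le hK hρ φ

theorem sum_outcomeProb_mul_CSF_le {r : ℕ} {K : Fin r → Matrix κ ι ℂ} (hK : IsIncoherentKraus K)
    {ρ : Matrix ι ι ℂ} (hρ : IsState ρ) :
    ∑ n, outcomeProb (K n) ρ * S.CSF (outcomeState (K n) ρ) ≤ S.CSF ρ := by
  obtain ⟨q, φ, hφ, hval⟩ := S.exists_CSF_eq hρ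
  have := (hK.isState_sum hρ).nonempty
  rw [hval]
  refine le_trans (Finset.sum_le_sum fun n _ => ?_) (S.sum_sum_pureCSF_le hK hρ φ)
  have hpos := hρ.1.mul_mul_conjTranspose_same (K n)
  have hnn := Complex.nonneg_iff.1 hpos.trace_nonneg
  have htr : (K n * ρ * (K n)ᴴ).trace = (outcomeProb (K n) ρ : ℂ) :=
    Complex.ext rfl hnn.2.symm
  -- At probability zero the outcome matrix is not a state, but its term is multiplied by 0.
  rcases (show 0 ≤ outcomeProb (K n) ρ from hnn.1).eq_or_lt with h0 | h0
  · rw [← h0, zero_mul]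
    exact Finset.sum_nonneg fun m _ => S.pureCSF_nonneg _
  · have hinv : 0 ≤ (outcomeProb (K n) ρ)⁻¹ := inv_nonneg.2 h0.le
    have hstate : IsState (outcomeState (K n) ρ) := by
      refine ⟨hpos.smul hinv, ?_⟩
      rw [outcomeState, Matrix.trace_smul, htr, Complex.real_smul, ← Complex.ofReal_mul,
        inv_mul_cancel₀ h0.ne', Complex.ofReal_one]
    have hle := S.CSF_le_sum hstate
      (fun m => ((Real.sqrt (outcomeProb (K n) ρ)⁻¹ : ℝ) : ℂ) • (K n *ᵥ φ m)) ?_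
    · simp only [pureCSF_smul, norm_sqrt_sq hinv, ← Finset.mul_sum] at hle
      calc outcomeProb (K n) ρ * S.CSF (outcomeState (K n) ρ)
          ≤ outcomeProb (K n) ρ *
            ((outcomeProb (K n) ρ)⁻¹ * ∑ m, S.pureCSF (K n *ᵥ φ m)) :=
            mul_le_mul_of_nonneg_left hle h0.le
        _ = _ := mul_inv_cancel_left₀ h0.ne' _
    · simp only [proj_smul, norm_sqrt_sq hinv, ← Finset.smul_sum, ← conj_proj]
      rw [← Matrix.sum_mul, ← Matrix.mul_sum, ← hφ]
      rfl

theorem CSF_convex {ρ σ : Matrix ι ι ℂ} (hρ : IsState ρ) (hσ : IsState σ) {t : ℝ} (h0 : 0 ≤ t)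
    (h1 : t ≤ 1) : S.CSF (t • ρ + (1 - t) • σ) ≤ t * S.CSF ρ + (1 - t) * S.CSF σ := by
  have h1' : 0 ≤ 1 - t := sub_nonneg.2 h1
  obtain ⟨q, φ, hφ, hval⟩ := S.exists_CSF_eq hρ
  obtain ⟨q', χ, hχ, hval'⟩ := S.exists_CSF_eq hσ
  have hstate : IsState (t • ρ + (1 - t) • σ) := by
    refine ⟨(hρ.1.smul h0).add (hσ.1.smul h1'), ?_⟩
    rw [Matrix.trace_add, Matrix.trace_smul, Matrix.trace_smul, hρ.2, hσ.2, ← add_smul,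
      add_sub_cancel, one_smul]
  -- Concatenate the two optimal decompositions, with t and 1 - t entering as square roots on the
  -- vectors.
  have hle := S.CSF_le_sum hstate (Sum.elim (fun m => ((Real.sqrt t : ℝ) : ℂ) • φ m)
    fun m => ((Real.sqrt (1 - t) : ℝ) : ℂ) • χ m) ?_
  · refine hle.trans (le_of_eq ?_)
    rw [Fintype.sum_sum_type, hval, hval']
    simp only [Sum.elim_inl, Sum.elim_inr, pureCSF_smul, norm_sqrt_sq h0, norm_sqrt_sq h1',
      Finset.mul_sum]
  · rw [Fintype.sum_sum_type]
    simp only [Sum.elim_inl, Sum.elim_inr, proj_smul, norm_sqrt_sq h0, norm_sqrt_sq h1',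
      ← Finset.smul_sum]
    rw [← hφ, ← hχ]

theorem isCoherenceMeasure_CSF (hM : 1 ≤ M) (hN : 1 ≤ N) :
    IsCoherenceMeasure (fun (ι : Type) [Fintype ι] [DecidableEq ι] => S.CSF (ι := ι)) where
  nonneg _ _ _ _ hρ := S.CSF_nonneg hρ
  eq_zero_iff _ _ _ _ hρ := S.CSF_eq_zero_iff hM hN hρ
  monotone _ _ _ _ _ _ _ hΦ _ hρ := S.CSF_map_le hΦ hρ
  strong_monotone _ _ _ _ _ _ _ _ hK _ hρ := S.sum_outcomeProb_mul_CSF_le hK hρ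
  convex _ _ _ _ _ hρ hσ _ h0 h1 := S.CSF_convex hρ hσ h0 h1

theorem isGreatest_pureCSF_of_isPure {ψ : ι → ℂ} (hψ : IsPure ψ) :
    IsGreatest (S.pureValues ψ) (S.pureCSF ψ) := by
  have : Nonempty ι := by
    by_contra h
    rw [not_nonempty_iff] at h
    simp [IsPure] at hψ
  exact S.isGreatest_pureCSF ψ

end Setup

end SFCoherence

end

theorem theorem4 (M N : ℕ) (hM : 1 ≤ M) (hN : 1 ≤ N) (S : SFCoherence.Setup M N) :
    -- the maximum over incoherent operations exists
    (∀ (ι : Type) [Fintype ι] [DecidableEq ι] (ψ : ι → ℂ), SFCoherence.IsPure ψ →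
      IsGreatest (S.pureValues ψ) (S.pureCSF ψ)) ∧
    -- the minimum over pure state decompositions exists
    (∀ (ι : Type) [Fintype ι] [DecidableEq ι] (ρ : Matrix ι ι ℂ), SFCoherence.IsState ρ →
      IsLeast (S.roofValues ρ) (S.CSF ρ)) ∧
    SFCoherence.IsCoherenceMeasure (fun (ι : Type) [Fintype ι] [DecidableEq ι] => S.CSF (ι := ι)) := by
  exact ⟨fun _ _ _ _ hψ => S.isGreatest_pureCSF_of_isPure hψ,
    fun _ _ _ _ hρ => S.isLeast_CSF hρ, S.isCoherenceMeasure_CSF hM hN⟩
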